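/- Let $W_2=\mathrm{Tot}(\mathcal O_{\mathbb P^1}(-2)\oplus\mathcal O_{\mathbb P^1}(0))$ be the complex threefold glued from $U=\mathbb C^3_{(z,u_1,u_2)}$ and $V=\mathbb C^3_{(\xi,v_1,v_2)}$ along $\{z\neq0\}\cong\{\xi\ne 0\}$ by $(\xi,v_1,v_2)=(z^{-1},z^2u_1,u_2)$, and let $H^1(W_2,TW_2)=\Gamma(U\cap V,TW_2)/(\Gamma(U,TW_2)+\Gamma(V,TW_2))$ be the first Čech cohomology of the tangent sheaf for the cover $\{U,V\}$. Let $T$ be the vector space of sequences $t=(t_j)_{j\ge0}$ in $\mathbb C$ such that $\sum_j t_jw^j$ converges for all $w\in\mathbb C$. A deformation of a complex manifold $X$ over a complex normed space $E$ is a Hausdorff complex manifold $\mathcal M$ with a surjective holomorphic submersion $\pi\colon\mathcal M\to E$ and a biholomorphism $X\cong\pi^{-1}(0)$, such that there is a $C^\infty$ diffeomorphism $\mathcal M\cong X\times E$ over $E$ that restricts to the given identification $X\cong X\times\{0\}$ on the central fibre. Then $W_2$ has an infinite-dimensional family of deformations. Precisely: 1. For the holomorphic tangent sheaf, $H^1(W_2,TW_2)$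 is generated by the cocycles $\sigma_j=(0,z^{-1}u_2^j,0)$, $j\ge0$ (components in the coordinates of $U$), in the sense of convergent series: the map $\Theta\colon T\to H^1(W_2,TW_2)$ sending $t$ to the class of $\left(0,z^{-1}\sum_{j\ge0}t_ju_2^j,0\right)$ is an isomorphism of vector spaces. In particular $H^1(W_2,TW_2)$ is infinite-dimensional. For the algebraic tangent sheaf (polynomial vector fields on $U$ and $V$, Laurent polynomial in $z$ on $U\cap V$) the classes of the $\sigma_j$ form a vector space basis of $H^1(W_2,TW_2)$. 2. Let $E$ be a complex normed space and let $L\colon E\to T$, $e\mapsto(t_j(e))_j$, be a linear map such that $(e,w)\mapsto\sum_jt_j(e)w^j$ is holomorphic on $E\times\mathbb C$. Glue $U\times E$ and $V\times E$ over $\{z\ne0\}$ by $$(\xi,v_1,v_2,e)=\Bigl(z^{-1},\;z^2u_1+\sum_{j\ge0}t_j(e)\,z\,u_2^j,\;u_2,\;e\Bigr).$$ The resulting space, with its projection to $E$, is a deformation of $W_2$ over $E$, whose Kodaira–Spencer map at $0$ is $e\mapsto\Theta(L(e))$. 3. The holomorphy condition in 2 holds for every linear map $L\colon E\to T$ with $E$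 finite-dimensional. It also holds for some injective linear map $L\colon E\to T$ with $E$ an infinite-dimensional Banach space whose image contains all finite sequences $(t_0,t_1,\dots,t_n,0,0,\dots)$. For such an $L$, 2 gives a deformation over an infinite-dimensional base with injective Kodaira–Spencer map. 4. Every class $c\in H^1(W_2,TW_2)$ (holomorphic) is integrable: it is the Kodaira–Spencer class of a one-parameter deformation of $W_2$ over $\mathbb C$ of the form in 2. -/

import Mathlib

open Set Filter Topology
open scoped Manifold ContDiff

noncomputable section

/-! ### Gluing two copies of a model space along a partial homeomorphism -/

namespace Gluing

variable {F : Type*} [TopologicalSpace F]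

/-- The equivalence relation on the disjoint union of two copies `U`, `V` of `F` that identifies
`p ∈ g.source ⊆ U` with `g p ∈ g.target ⊆ V`. -/
def Rel (g : OpenPartialHomeomorph F F) : F ⊕ F → F ⊕ F → Prop
  | .inl p, .inl q => p = q
  | .inr p, .inr q => p = q
  | .inl p, .inr q => p ∈ g.source ∧ g p = q
  | .inr q, .inl p => p ∈ g.source ∧ g p = q

/-- The gluing relation as a setoid. -/
def setoid (g : OpenPartialHomeomorph F F) : Setoid (F ⊕ F) where
  r := Rel g
  iseqv :=
    { refl := by rintro (p | p) <;> rfl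
      symm := by
        rintro (p | p) (q | q) h
        · exact Eq.symm h
        · exact h
        · exact h
        · exact Eq.symm h
      trans := by
        rintro (p | p) (q | q) (r | r) h₁ h₂
        · exact Eq.trans h₁ h₂
        · obtain rfl : p = q := h₁
          exact h₂
        · exact g.injOn h₁.1 h₂.1 (h₁.2.trans h₂.2.symm)
        · exact ⟨h₁.1, h₁.2.trans h₂⟩
        · obtain rfl : q = r := h₂
          exact h₁
        · exact h₁.2.symm.trans h₂.2
        · exact ⟨h₂.1, h₂.2.trans (Eq.symm h₁)⟩
        · exact Eq.trans h₁ h₂ }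

end Gluing

/-- The space `U ∪ V` glued from two copies `U`, `V` of `F` along the transition map `g`. -/
def Glued {F : Type*} [TopologicalSpace F] (g : OpenPartialHomeomorph F F) : Type _ :=
  Quotient (Gluing.setoid g)

namespace Glued

variable {F : Type*} [TopologicalSpace F] {g : OpenPartialHomeomorph F F}

instance : TopologicalSpace (Glued g) :=
  inferInstanceAs (TopologicalSpace (Quotient (Gluing.setoid g)))

/-- The inclusion of the first copy `U`. -/
def inU (p : F) : Glued g := Quotient.mk (Gluing.setoid g) (.inl p)

/-- The inclusion of the second copy `V`. -/
def inV (p : F) : Glued g := Quotient.mk (Gluing.setoid g) (.inr p)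

/-- Maps out of a glued space: a pair of maps which agree on the overlap. -/
def lift {Y : Type*} (a b : F → Y) (h : ∀ p ∈ g.source, a p = b (g p)) : Glued g → Y :=
  Quotient.lift (s := Gluing.setoid g) (Sum.elim a b) (by
    rintro (p | p) (q | q) hpq
    · exact congrArg a hpq
    · obtain ⟨hp, rfl⟩ := hpq
      exact h p hp
    · obtain ⟨hp, rfl⟩ := hpq
      exact (h q hp).symm
    · exact congrArg b hpq)

theorem inU_eq_inV_iff {p q : F} : (inU p : Glued g) = inV q ↔ p ∈ g.source ∧ g p = q :=
  Quotient.eq (r := Gluing.setoid g)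

theorem inU_injective : Function.Injective (inU : F → Glued g) :=
  fun _ _ h => (Quotient.eq (r := Gluing.setoid g)).1 h

theorem inV_injective : Function.Injective (inV : F → Glued g) :=
  fun _ _ h => (Quotient.eq (r := Gluing.setoid g)).1 h

theorem exists_rep (x : Glued g) : (∃ p, inU p = x) ∨ ∃ p, inV p = x := by
  obtain ⟨p | p, rfl⟩ := Quotient.exists_rep x
  · exact .inl ⟨p, rfl⟩
  · exact .inr ⟨p, rfl⟩

theorem isOpen_iff {s : Set (Glued g)} :
    IsOpen s ↔ IsOpen (inU ⁻¹' s) ∧ IsOpen (inV ⁻¹' s) := by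
  have h : IsOpen s ↔ IsOpen (Quotient.mk (Gluing.setoid g) ⁻¹' s) :=
    (isQuotientMap_quotient_mk' (s := Gluing.setoid g)).isOpen_preimage.symm
  rw [h, isOpen_sum_iff]
  rfl

theorem isOpenEmbedding_inU : IsOpenEmbedding (inU : F → Glued g) := by
  refine .of_continuous_injective_isOpenMap ?_ inU_injective ?_
  · exact ⟨fun s hs => (isOpen_iff.1 hs).1⟩
  · intro s hs
    refine isOpen_iff.2 ⟨by rwa [inU_injective.preimage_image], ?_⟩
    have : (inV : F → Glued g) ⁻¹' (inU '' s) = g '' (g.source ∩ s) := by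
      ext q
      constructor
      · rintro ⟨p, hp, h⟩
        obtain ⟨h₁, h₂⟩ := inU_eq_inV_iff.1 h
        exact ⟨p, ⟨h₁, hp⟩, h₂⟩
      · rintro ⟨p, ⟨h₁, hp⟩, h₂⟩
        exact ⟨p, hp, inU_eq_inV_iff.2 ⟨h₁, h₂⟩⟩
    rw [this]
    exact g.isOpen_image_source_inter hs

theorem isOpenEmbedding_inV : IsOpenEmbedding (inV : F → Glued g) := by
  refine .of_continuous_injective_isOpenMap ?_ inV_injective ?_
  · exact ⟨fun s hs => (isOpen_iff.1 hs).2⟩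
  · intro s hs
    refine isOpen_iff.2 ⟨?_, by rwa [inV_injective.preimage_image]⟩
    have : (inU : F → Glued g) ⁻¹' (inV '' s) = g.source ∩ g ⁻¹' s := by
      ext p
      constructor
      · rintro ⟨q, hq, h⟩
        obtain ⟨h₁, rfl⟩ := inU_eq_inV_iff.1 h.symm
        exact ⟨h₁, hq⟩
      · rintro ⟨h₁, h₂⟩
        exact ⟨g p, h₂, (inU_eq_inV_iff.2 ⟨h₁, rfl⟩).symm⟩
    rw [this]
    exact g.isOpen_inter_preimage hs

variable [Nonempty F]

/-- The coordinate chart on `U`. -/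
def chartU (g : OpenPartialHomeomorph F F) : OpenPartialHomeomorph (Glued g) F :=
  (isOpenEmbedding_inU.toOpenPartialHomeomorph inU).symm

/-- The coordinate chart on `V`. -/
def chartV (g : OpenPartialHomeomorph F F) : OpenPartialHomeomorph (Glued g) F :=
  (isOpenEmbedding_inV.toOpenPartialHomeomorph inV).symm

theorem chartU_source : (chartU g).source = range inU := by
  simp [chartU]

theorem chartV_source : (chartV g).source = range inV := by
  simp [chartV]

theorem chartU_symm_apply (p : F) : (chartU g).symm p = inU p := rfl

theorem chartV_symm_apply (p : F) : (chartV g).symm p = inV p := rfl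

theorem chartU_inU (p : F) : chartU g (inU p) = p :=
  isOpenEmbedding_inU.toOpenPartialHomeomorph_left_inv inU

theorem chartV_inV (p : F) : chartV g (inV p) = p :=
  isOpenEmbedding_inV.toOpenPartialHomeomorph_left_inv inV

/-- The atlas consisting of the two charts `U` and `V`. -/
instance : ChartedSpace F (Glued g) where
  atlas := {chartU g, chartV g}
  chartAt x := by
    classical
    exact if x ∈ range inU then chartU g else chartV g
  mem_chart_source x := by
    split_ifs with h
    · rwa [chartU_source]
    · rw [chartV_source]
      exact (exists_rep x).resolve_left h
  chart_mem_atlas x := by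
    split_ifs <;> simp

end Glued

/-- A space glued along a biholomorphic transition map is a complex manifold. -/
theorem Glued.isManifold {F : Type*} [NormedAddCommGroup F] [NormedSpace ℂ F]
    (g : OpenPartialHomeomorph F F) (hg : ContDiffOn ℂ ω g g.source)
    (hg' : ContDiffOn ℂ ω g.symm g.target) : IsManifold 𝓘(ℂ, F) ω (Glued g) := by
  apply isManifold_of_contDiffOn
  have key : ∀ e e' : OpenPartialHomeomorph (Glued g) F,
      (e = chartU g ∨ e = chartV g) → (e' = chartU g ∨ e' = chartV g) →
      ContDiffOn ℂ ω (e.symm.trans e') (e.symm.trans e').source := by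
    rintro e e' (rfl | rfl) (rfl | rfl)
    · exact contDiffOn_id.congr fun p _ => chartU_inU p
    · have hs : ∀ p ∈ ((chartU g).symm.trans (chartV g)).source, p ∈ g.source ∧
          (chartV g) (inU p) = g p := by
        intro p hp
        have h : (inU p : Glued g) ∈ (chartV g).source := hp.2
        rw [chartV_source] at h
        obtain ⟨q, hq⟩ := h
        obtain ⟨h₁, rfl⟩ := inU_eq_inV_iff.1 hq.symm
        exact ⟨h₁, by rw [← hq, chartV_inV]⟩
      exact (hg.mono fun p hp => (hs p hp).1).congr fun p hp => (hs p hp).2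
    · have hs : ∀ q ∈ ((chartV g).symm.trans (chartU g)).source, q ∈ g.target ∧
          (chartU g) (inV q) = g.symm q := by
        intro q hq
        have h : (inV q : Glued g) ∈ (chartU g).source := hq.2
        rw [chartU_source] at h
        obtain ⟨p, hp⟩ := h
        obtain ⟨h₁, rfl⟩ := inU_eq_inV_iff.1 hp
        exact ⟨g.map_source h₁, by rw [← hp, chartU_inU, g.left_inv h₁]⟩
      exact (hg'.mono fun p hp => (hs p hp).1).congr fun p hp => (hs p hp).2
    · exact contDiffOn_id.congr fun p _ => chartV_inV p
  intro e e' he he'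
  simpa using key e e' he he'

/-! ### The threefolds `W_k` -/

/-- Coordinates `(z, u₁, u₂)`. -/
abbrev C3 : Type := ℂ × ℂ × ℂ

/-- The transition `(z, u₁, u₂) ↦ (z⁻¹, z⁻ᵃ u₁, z⁻ᵇ u₂)` of `Tot(𝒪(a) ⊕ 𝒪(b))` over `ℙ¹`, a
homeomorphism of `{z ≠ 0}` onto `{ξ ≠ 0}`. -/
def totTransition (a b : ℤ) : OpenPartialHomeomorph C3 C3 where
  toFun p := (p.1⁻¹, p.1 ^ (-a) * p.2.1, p.1 ^ (-b) * p.2.2)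
  invFun q := (q.1⁻¹, q.1 ^ (-a) * q.2.1, q.1 ^ (-b) * q.2.2)
  source := {p | p.1 ≠ 0}
  target := {q | q.1 ≠ 0}
  map_source' p hp := inv_ne_zero hp
  map_target' p hp := inv_ne_zero hp
  left_inv' := by
    rintro ⟨z, u, w⟩ (hz : z ≠ 0)
    have h : ∀ (n : ℤ) (y : ℂ), z⁻¹ ^ n * (z ^ n * y) = y := fun n y => by
      rw [← mul_assoc, ← mul_zpow, inv_mul_cancel₀ hz, one_zpow, one_mul]
    simp only [inv_inv, h]
  right_inv' := by
    rintro ⟨z, u, w⟩ (hz : z ≠ 0)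
    have h : ∀ (n : ℤ) (y : ℂ), z⁻¹ ^ n * (z ^ n * y) = y := fun n y => by
      rw [← mul_assoc, ← mul_zpow, inv_mul_cancel₀ hz, one_zpow, one_mul]
    simp only [inv_inv, h]
  open_source := isOpen_ne_fun continuous_fst continuous_const
  open_target := isOpen_ne_fun continuous_fst continuous_const
  continuousOn_toFun := by
    have h : ∀ n : ℤ, ContinuousOn (fun p : C3 => p.1 ^ n) {p | p.1 ≠ 0} := fun n =>
      continuousOn_fst.zpow₀ n fun p hp => .inl hp
    exact (continuousOn_fst.inv₀ fun p hp => hp).prodMk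
      (((h _).mul (by fun_prop)).prodMk ((h _).mul (by fun_prop)))
  continuousOn_invFun := by
    have h : ∀ n : ℤ, ContinuousOn (fun p : C3 => p.1 ^ n) {p | p.1 ≠ 0} := fun n =>
      continuousOn_fst.zpow₀ n fun p hp => .inl hp
    exact (continuousOn_fst.inv₀ fun p hp => hp).prodMk
      (((h _).mul (by fun_prop)).prodMk ((h _).mul (by fun_prop)))

/-- The total space of `𝒪(a) ⊕ 𝒪(b)` over `ℙ¹`, in its two canonical charts. -/
abbrev Tot (a b : ℤ) : Type := Glued (totTransition a b)

theorem totTransition_contDiffOn (a b : ℤ) :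
    ContDiffOn ℂ ω (fun p : C3 => (p.1⁻¹, p.1 ^ (-a) * p.2.1, p.1 ^ (-b) * p.2.2))
      {p : C3 | p.1 ≠ 0} := by
  have h0 : ContDiffOn ℂ ω (fun p : C3 => p.1⁻¹) {p : C3 | p.1 ≠ 0} :=
    contDiffOn_fst.inv fun p hp => hp
  have h : ∀ n : ℤ, ContDiffOn ℂ ω (fun p : C3 => p.1 ^ n) {p : C3 | p.1 ≠ 0} := by
    intro n
    cases n with
    | ofNat n => simpa using contDiffOn_fst.pow n
    | negSucc n => simpa [zpow_negSucc] using h0.pow (n + 1)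
  exact h0.prodMk (((h _).mul (by fun_prop)).prodMk ((h _).mul (by fun_prop)))

instance (a b : ℤ) : IsManifold 𝓘(ℂ, C3) ω (Tot a b) :=
  Glued.isManifold _ (totTransition_contDiffOn a b) (totTransition_contDiffOn a b)

/-- `W_k = Tot(𝒪(-k) ⊕ 𝒪(k-2))`, so that `(ξ, v₁, v₂) = (z⁻¹, zᵏ u₁, z²⁻ᵏ u₂)`. -/
abbrev W (k : ℤ) : Type := Tot (-k) (k - 2)

/-! ### First Čech cohomology of the tangent sheaf for a cover by two open sets -/

section Cech

variable {F : Type*} [NormedAddCommGroup F] [NormedSpace ℂ F]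
  (X : Type*) [TopologicalSpace X] [ChartedSpace F X]

/-- All (not necessarily continuous) vector fields on `X`. -/
abbrev VField : Type _ := (x : X) → TangentSpace 𝓘(ℂ, F) x

variable {X}

/-- `Γ(O, TX)`: vector fields holomorphic on `O`. Values outside `O` are not constrained; they are
divided out in `CechH1`. -/
def holVField [IsManifold 𝓘(ℂ, F) ω X] (O : Set X) : Submodule ℂ (VField (F := F) X) where
  carrier := {s | ContMDiffOn 𝓘(ℂ, F) 𝓘(ℂ, F).tangent ω
    (fun x => (⟨x, s x⟩ : TangentBundle 𝓘(ℂ, F) X)) O}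
  add_mem' hs ht := ContMDiffOn.add_section hs ht
  zero_mem' := (Bundle.contMDiff_zeroSection ℂ (TangentSpace 𝓘(ℂ, F) : X → Type _)).contMDiffOn
  smul_mem' _ _ hs := ContMDiffOn.const_smul_section hs

/-- Vector fields that agree on `O` with a difference of an element of `SU` and one of `SV`. -/
def coboundaries (SU SV : Submodule ℂ (VField (F := F) X)) (O : Set X) :
    Submodule ℂ (VField (F := F) X) where
  carrier := {s | ∃ a ∈ SU, ∃ b ∈ SV, ∀ x ∈ O, s x = a x - b x}
  add_mem' := by
    rintro s t ⟨a, ha, b, hb, h⟩ ⟨a', ha', b', hb', h'⟩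
    refine ⟨a + a', SU.add_mem ha ha', b + b', SV.add_mem hb hb', fun x hx => ?_⟩
    rw [Pi.add_apply, Pi.add_apply, Pi.add_apply, h x hx, h' x hx]
    abel
  zero_mem' := ⟨0, SU.zero_mem, 0, SV.zero_mem, fun x _ => (sub_zero _).symm⟩
  smul_mem' := by
    rintro c s ⟨a, ha, b, hb, h⟩
    refine ⟨c • a, SU.smul_mem c ha, c • b, SV.smul_mem c hb, fun x hx => ?_⟩
    rw [Pi.smul_apply, Pi.smul_apply, Pi.smul_apply, h x hx, smul_sub]

/-- `Γ(U ∩ V) / (Γ(U) + Γ(V))`, where `SU`, `SV`, `S` are the sections over `U`, `V`, `O = U ∩ V`. -/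
abbrev CechH1 (SU SV S : Submodule ℂ (VField (F := F) X)) (O : Set X) : Type _ :=
  S ⧸ (coboundaries SU SV O).submoduleOf S

/-- `H¹({U, V}, TX)` for the holomorphic tangent sheaf of `X`. -/
abbrev TangentH1 [IsManifold 𝓘(ℂ, F) ω X] (U V : Set X) : Type _ :=
  CechH1 (holVField (F := F) U) (holVField V) (holVField (U ∩ V)) (U ∩ V)

end Cech

/-! ### Deformations and their Kodaira–Spencer classes -/

section Deformation

variable {F : Type*} [NormedAddCommGroup F] [NormedSpace ℂ F]
  {X : Type*} [TopologicalSpace X] [ChartedSpace F X]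
  {G : Type*} [NormedAddCommGroup G] [NormedSpace ℂ G]
  {M : Type*} [TopologicalSpace M] [ChartedSpace G M]
  {E : Type*} [NormedAddCommGroup E] [NormedSpace ℂ E]

/-- `π : M → E`, together with `ι : X → M`, is a deformation of the complex manifold `X` with base
the complex vector space `E` and central fibre over `b`: `π` is a surjective holomorphic submersion
of complex manifolds, `ι` is a biholomorphism of `X` onto the fibre `π⁻¹(b)`, and the family is
trivial as a family of `C^∞` manifolds, compatibly with `ι` (only the complex structure varies). -/
structure IsDeformation [NormedSpace ℝ F] [IsScalarTower ℝ ℂ F]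
    [NormedSpace ℝ G] [IsScalarTower ℝ ℂ G] [NormedSpace ℝ E] [IsScalarTower ℝ ℂ E]
    [IsManifold 𝓘(ℂ, F) ω X] [IsManifold 𝓘(ℂ, G) ω M]
    (ι : X → M) (π : M → E) (b : E) : Prop where
  hausdorff : T2Space M
  submersion : Manifold.IsSubmersion 𝓘(ℂ, G) 𝓘(ℂ, E) ω π
  surjective : Function.Surjective π
  embedding : Manifold.IsSmoothEmbedding 𝓘(ℂ, F) 𝓘(ℂ, G) ω ι
  range_eq : range ι = π ⁻¹' {b}
  smoothly_trivial : ∃ Ψ : Diffeomorph 𝓘(ℝ, G) (𝓘(ℝ, F).prod 𝓘(ℝ, E)) M (X × E) ∞,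
    (∀ m, (Ψ m).2 = π m) ∧ ∀ x, Ψ (ι x) = (x, b)

/-- A holomorphic lift over `O ⊆ X` of the tangent vector `e` of the base: a holomorphic section
of `ι^* TM` over `O` which is mapped to `e` by `dπ`. -/
structure IsLift [IsManifold 𝓘(ℂ, G) ω M] (ι : X → M) (π : M → E) (O : Set X) (e : E)
    (a : (x : X) → TangentSpace 𝓘(ℂ, G) (ι x)) : Prop where
  holomorphic : ContMDiffOn 𝓘(ℂ, F) 𝓘(ℂ, G).tangent ω
    (fun x => (⟨ι x, a x⟩ : TangentBundle 𝓘(ℂ, G) M)) O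
  lift : ∀ x ∈ O, mfderiv 𝓘(ℂ, G) 𝓘(ℂ, E) π (ι x) (a x) = e

/-- `c` is the Kodaira–Spencer class of the tangent vector `e` of the base: the image of `e` under
the connecting map of `0 → TX → ι^* TM → E → 0`, that is, `c` is represented by the difference
`a_U - a_V` of holomorphic lifts of `e` over `U` and over `V`. -/
def IsKodairaSpencerClass [IsManifold 𝓘(ℂ, F) ω X] [IsManifold 𝓘(ℂ, G) ω M]
    (ι : X → M) (π : M → E) (U V : Set X) (e : E) (c : TangentH1 (F := F) U V) : Prop :=
  ∃ θ : holVField (F := F) (U ∩ V), Submodule.Quotient.mk θ = c ∧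
    ∃ a b : (x : X) → TangentSpace 𝓘(ℂ, G) (ι x),
      IsLift (F := F) ι π U e a ∧ IsLift (F := F) ι π V e b ∧
      ∀ x ∈ U ∩ V, mfderiv 𝓘(ℂ, F) 𝓘(ℂ, G) ι x (θ.1 x) = a x - b x

end Deformation

/-! ### Vector fields on `W₂` in canonical coordinates -/

/-- The chart domain `U = {(z, u₁, u₂)}` of `W₂`. -/
def W2U : Set (W 2) := range Glued.inU

/-- The chart domain `V = {(ξ, v₁, v₂)}` of `W₂`. -/
def W2V : Set (W 2) := range Glued.inV

/-- On `U ∩ V = {z ≠ 0}`, the vector field `s` has components `σ` in the coordinates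
`(z, u₁, u₂)`. -/
def HasCoords (s : VField (F := C3) (W 2)) (σ : C3 → C3) : Prop :=
  ∀ p : C3, p.1 ≠ 0 → s (Glued.inU p) = mfderiv 𝓘(ℂ, C3) 𝓘(ℂ, C3) Glued.inU p (σ p)

/-- `H¹(W₂, TW₂)`: holomorphic tangent fields, with respect to the canonical cover `{U, V}`. -/
abbrev H1TW2 : Type := TangentH1 (F := C3) W2U W2V

/-- Polynomial functions of three variables. -/
def polyFun : Subalgebra ℂ (C3 → ℂ) :=
  Algebra.adjoin ℂ {fun p => p.1, fun p => p.2.1, fun p => p.2.2}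

/-- Polynomial maps `ℂ³ → ℂ³`. -/
def polyMap : Submodule ℂ (C3 → C3) where
  carrier := {P | (fun p => (P p).1) ∈ polyFun ∧ (fun p => (P p).2.1) ∈ polyFun ∧
    (fun p => (P p).2.2) ∈ polyFun}
  add_mem' ha hb := ⟨add_mem ha.1 hb.1, add_mem ha.2.1 hb.2.1, add_mem ha.2.2 hb.2.2⟩
  zero_mem' := ⟨zero_mem _, zero_mem _, zero_mem _⟩
  smul_mem' c _ ha :=
    ⟨polyFun.smul_mem ha.1 c, polyFun.smul_mem ha.2.1 c, polyFun.smul_mem ha.2.2 c⟩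

/-- Vector fields that are algebraic (polynomial) on `U`. -/
def algU : Submodule ℂ (VField (F := C3) (W 2)) where
  carrier := {s | ∃ P ∈ polyMap, ∀ p,
    s (Glued.inU p) = mfderiv 𝓘(ℂ, C3) 𝓘(ℂ, C3) Glued.inU p (P p)}
  add_mem' := by
    rintro s t ⟨P, hP, h⟩ ⟨Q, hQ, h'⟩
    refine ⟨P + Q, add_mem hP hQ, fun p => ?_⟩
    rw [Pi.add_apply, h, h']
    exact (map_add (mfderiv 𝓘(ℂ, C3) 𝓘(ℂ, C3) Glued.inU p) (P p) (Q p)).symm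
  zero_mem' := ⟨0, zero_mem _, fun p =>
    (map_zero (mfderiv 𝓘(ℂ, C3) 𝓘(ℂ, C3) Glued.inU p)).symm⟩
  smul_mem' := by
    rintro c s ⟨P, hP, h⟩
    refine ⟨c • P, polyMap.smul_mem c hP, fun p => ?_⟩
    rw [Pi.smul_apply, h]
    exact (map_smul (mfderiv 𝓘(ℂ, C3) 𝓘(ℂ, C3) Glued.inU p) c (P p)).symm

/-- Vector fields that are algebraic (polynomial) on `V`. -/
def algV : Submodule ℂ (VField (F := C3) (W 2)) where
  carrier := {s | ∃ P ∈ polyMap, ∀ p,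
    s (Glued.inV p) = mfderiv 𝓘(ℂ, C3) 𝓘(ℂ, C3) Glued.inV p (P p)}
  add_mem' := by
    rintro s t ⟨P, hP, h⟩ ⟨Q, hQ, h'⟩
    refine ⟨P + Q, add_mem hP hQ, fun p => ?_⟩
    rw [Pi.add_apply, h, h']
    exact (map_add (mfderiv 𝓘(ℂ, C3) 𝓘(ℂ, C3) Glued.inV p) (P p) (Q p)).symm
  zero_mem' := ⟨0, zero_mem _, fun p =>
    (map_zero (mfderiv 𝓘(ℂ, C3) 𝓘(ℂ, C3) Glued.inV p)).symm⟩
  smul_mem' := by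
    rintro c s ⟨P, hP, h⟩
    refine ⟨c • P, polyMap.smul_mem c hP, fun p => ?_⟩
    rw [Pi.smul_apply, h]
    exact (map_smul (mfderiv 𝓘(ℂ, C3) 𝓘(ℂ, C3) Glued.inV p) c (P p)).symm

/-- Vector fields that are algebraic on `U ∩ V`: components in `ℂ[z, z⁻¹, u₁, u₂]`. -/
def algUV : Submodule ℂ (VField (F := C3) (W 2)) where
  carrier := {s | ∃ n : ℕ, ∃ P ∈ polyMap, HasCoords s fun p => (p.1 ^ n)⁻¹ • P p}
  add_mem' := by
    rintro s t ⟨n, P, hP, h⟩ ⟨m, Q, hQ, h'⟩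
    have hz : ∀ k : ℕ, (fun p : C3 => p.1 ^ k) ∈ polyFun := fun k =>
      pow_mem (Algebra.subset_adjoin (by simp)) k
    refine ⟨n + m, fun p => p.1 ^ m • P p + p.1 ^ n • Q p,
      add_mem ⟨mul_mem (hz m) hP.1, mul_mem (hz m) hP.2.1, mul_mem (hz m) hP.2.2⟩
        ⟨mul_mem (hz n) hQ.1, mul_mem (hz n) hQ.2.1, mul_mem (hz n) hQ.2.2⟩, fun p hp => ?_⟩
    have e : (p.1 ^ (n + m))⁻¹ • (p.1 ^ m • P p + p.1 ^ n • Q p)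
        = (p.1 ^ n)⁻¹ • P p + (p.1 ^ m)⁻¹ • Q p := by
      rw [smul_add, smul_smul, smul_smul]
      congr 2 <;> field_simp <;> ring
    rw [Pi.add_apply, h p hp, h' p hp]
    simp only [e]
    exact (map_add (mfderiv 𝓘(ℂ, C3) 𝓘(ℂ, C3) Glued.inU p) _ _).symm
  zero_mem' := ⟨0, 0, zero_mem _, fun p _ => by
    simp only [Pi.zero_apply, smul_zero]
    exact (map_zero (mfderiv 𝓘(ℂ, C3) 𝓘(ℂ, C3) Glued.inU p)).symm⟩
  smul_mem' := by
    rintro c s ⟨n, P, hP, h⟩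
    refine ⟨n, c • P, polyMap.smul_mem c hP, fun p hp => ?_⟩
    rw [Pi.smul_apply, h p hp]
    simp only [Pi.smul_apply]
    rw [smul_comm]
    exact (map_smul (mfderiv 𝓘(ℂ, C3) 𝓘(ℂ, C3) Glued.inU p) c _).symm

/-- `H¹(W₂, TW₂)` of the algebraic tangent sheaf, with respect to the canonical cover `{U, V}`. -/
abbrev H1TW2alg : Type := CechH1 algU algV algUV (W2U ∩ W2V)

/-! ### The explicit family -/

/-- The parameters `t = (t₀, t₁, …)` for which `∑ tⱼ wʲ` converges for every `w ∈ ℂ`. -/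
def Param : Submodule ℂ (ℕ → ℂ) where
  carrier := {t | ∀ w : ℂ, Summable fun j => t j * w ^ j}
  add_mem' hs ht w := by
    simpa [add_mul] using (hs w).add (ht w)
  zero_mem' w := by simp
  smul_mem' c t ht w := by
    simpa [mul_assoc] using (ht w).mul_left c

/-- The entire function `∑ⱼ tⱼ wʲ`. -/
def entireSum (t : Param) (w : ℂ) : ℂ := ∑' j, t.1 j * w ^ j

/-- The parameter whose `j`-th entry is `1` and whose other entries are `0`. -/
def Param.single (j : ℕ) : Param :=
  ⟨Pi.single j 1, fun w => summable_of_ne_finset_zero (s := {j}) fun i hi => by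
    rw [Pi.single_eq_of_ne (by simpa using hi), zero_mul]⟩

section Family

variable {E : Type} [NormedAddCommGroup E] [NormedSpace ℂ E]

/-- The coordinates `t₀, t₁, …`, as linear functions on `E`, make `∑ⱼ tⱼ(e) wʲ` a holomorphic
function of `(e, w) ∈ E × ℂ`. -/
def IsHolParam (L : E →ₗ[ℂ] Param) : Prop :=
  ContDiff ℂ ω fun q : E × ℂ => entireSum (L q.1) q.2

/-- The transition `(ξ, v₁, v₂, e) = (z⁻¹, z² u₁ + ∑ⱼ tⱼ(e) z u₂ʲ, u₂, e)`. -/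
def famTransition (L : E →ₗ[ℂ] Param) (hL : IsHolParam L) :
    OpenPartialHomeomorph (C3 × E) (C3 × E) where
  toFun p := ((p.1.1⁻¹, p.1.1 ^ 2 * p.1.2.1 + p.1.1 * entireSum (L p.2) p.1.2.2, p.1.2.2), p.2)
  invFun q := ((q.1.1⁻¹, q.1.1 ^ 2 * q.1.2.1 - q.1.1 * entireSum (L q.2) q.1.2.2, q.1.2.2), q.2)
  source := {p | p.1.1 ≠ 0}
  target := {q | q.1.1 ≠ 0}
  map_source' p hp := inv_ne_zero hp
  map_target' p hp := inv_ne_zero hp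
  left_inv' := by
    rintro ⟨⟨z, u, w⟩, e⟩ (hz : z ≠ 0)
    simp only [Prod.mk.injEq, and_true, inv_inv, true_and]
    field_simp
    ring
  right_inv' := by
    rintro ⟨⟨z, u, w⟩, e⟩ (hz : z ≠ 0)
    simp only [Prod.mk.injEq, and_true, inv_inv, true_and]
    field_simp
    ring
  open_source := isOpen_ne_fun (by fun_prop) continuous_const
  open_target := isOpen_ne_fun (by fun_prop) continuous_const
  continuousOn_toFun := by
    have h : Continuous fun p : C3 × E => entireSum (L p.2) p.1.2.2 :=
      hL.continuous.comp (g := fun q : E × ℂ => entireSum (L q.1) q.2)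
        (f := fun p : C3 × E => (p.2, p.1.2.2)) (by fun_prop)
    have h0 : ContinuousOn (fun p : C3 × E => p.1.1⁻¹) {p | p.1.1 ≠ 0} :=
      ContinuousOn.inv₀ (by fun_prop) fun p hp => hp
    exact (h0.prodMk (Continuous.continuousOn (by fun_prop))).prodMk (by fun_prop)
  continuousOn_invFun := by
    have h : Continuous fun p : C3 × E => entireSum (L p.2) p.1.2.2 :=
      hL.continuous.comp (g := fun q : E × ℂ => entireSum (L q.1) q.2)
        (f := fun p : C3 × E => (p.2, p.1.2.2)) (by fun_prop)
    have h0 : ContinuousOn (fun p : C3 × E => p.1.1⁻¹) {p | p.1.1 ≠ 0} :=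
      ContinuousOn.inv₀ (by fun_prop) fun p hp => hp
    exact (h0.prodMk (Continuous.continuousOn (by fun_prop))).prodMk (by fun_prop)

/-- The total space `(U × E) ∪ (V × E)` of the explicit family. -/
abbrev Fam (L : E →ₗ[ℂ] Param) (hL : IsHolParam L) : Type := Glued (famTransition L hL)

instance (L : E →ₗ[ℂ] Param) (hL : IsHolParam L) : IsManifold 𝓘(ℂ, C3 × E) ω (Fam L hL) := by
  have h : ContDiff ℂ ω fun p : C3 × E => entireSum (L p.2) p.1.2.2 :=
    ContDiff.comp (g := fun q : E × ℂ => entireSum (L q.1) q.2)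
      (f := fun p : C3 × E => (p.2, p.1.2.2)) hL (by fun_prop)
  have h0 : ContDiffOn ℂ ω (fun p : C3 × E => p.1.1⁻¹) {p | p.1.1 ≠ 0} :=
    ContDiffOn.inv (by fun_prop) fun p hp => hp
  refine Glued.isManifold _ ?_ ?_
  · exact (h0.prodMk (ContDiff.contDiffOn (by fun_prop))).prodMk (by fun_prop)
  · exact (h0.prodMk (ContDiff.contDiffOn (by fun_prop))).prodMk (by fun_prop)

/-- The projection of the family to its base. -/
def Fam.proj (L : E →ₗ[ℂ] Param) (hL : IsHolParam L) : Fam L hL → E :=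
  Glued.lift Prod.snd Prod.snd fun _ _ => rfl

/-- The identification of `W₂` with the fibre over `0`. -/
def Fam.incl (L : E →ₗ[ℂ] Param) (hL : IsHolParam L) : W 2 → Fam L hL :=
  Glued.lift (fun p => Glued.inU (p, 0)) (fun q => Glued.inV (q, 0)) (by
    intro p hp
    refine Glued.inU_eq_inV_iff.2 ⟨hp, ?_⟩
    simp [famTransition, totTransition, entireSum])

end Family

end

/-! A field on `U ∩ V` is a triple of functions holomorphic in `z ≠ 0` and entire in `u₁, u₂`. Each
splits into a part entire in `z` and `z⁻¹` times a part entire in `z⁻¹` (`laurent_decomposition`).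
Since `u₁ = ξ² v₁` and `u₂ = v₂`, everything holomorphic in `(z⁻¹, u₁, u₂)` extends to `V`. In
`U`-components a field `(b₁, b₂, b₃)` on `V` reads `(-z² b₁, 2 z u₁ b₁ + z⁻² b₂, b₃)`, so the polar
parts of the first and third components are absorbed by `V`. In the second component `V` absorbs the
exponents `≤ -2` of `z`, and `z⁻¹ u₁ g(u₁, u₂)` as well, because a factor `u₁` supplies `ξ²`. What
remains is `z⁻¹ T(u₂)` with `T` entire (`exists_splitting`).

Conversely, if `(0, z⁻¹ T(u₂), 0)` is a coboundary, then on `u₁ = 0` the function `z A₂ - T`, entire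
in `z`, equals `ξ B₂` with `ξ = z⁻¹`; by Liouville it is constantly `0`, and `z = 0` gives `T = 0`
(`eq_zero_of_splitting`). Taylor coefficients identify the functions `T` with `Param`, which gives
the isomorphism `Tot.theta`. The algebraic statement follows from the same computation on monomials,
with the same uniqueness argument.

The glued family is Hausdorff because the graph of its transition is closed. It is smoothly trivial
because `z⁻¹` splits smoothly: `u₁ + T z̄ / (1 + |z|²)` and `v₁ - T ξ̄ / (1 + |ξ|²)` are again
related by `z²` (`Fam.shift_transition`). Lifting `e` on each chart with zero component in `ℂ³`, the
difference of the lifts is the derivative of the transition in direction `e`, which is the cocycle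
of `L e` (`Fam.isKodairaSpencerClass_iff`).

For the infinite-dimensional base, take bounded sequences `x` with `tⱼ = xⱼ / j!`. Then `∑ tⱼ wʲ` is
the zeroth entry of `exp(w S) x`, where `S` is the left shift, so it is holomorphic in `(x, w)`. -/

noncomputable section

/-! ### Holomorphic dependence of Cauchy integrals on parameters. -/

section

open MeasureTheory
open scoped BoundedContinuousFunction

section Parametric

variable {P : Type*} [NormedAddCommGroup P] [NormedSpace ℂ P]

/-- A bounded function that stays away from `0` is a unit of the Banach algebra `X →ᵇ ℂ`, and
inversion is analytic on units. This lets a whole family of Cauchy kernels vary analytically at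
once, without differentiation under the integral sign. -/
theorem BoundedContinuousFunction.contDiffAt_inv {X : Type*} [TopologicalSpace X]
    {A : P → X →ᵇ ℂ} {p : P} (hA : ContDiffAt ℂ ω A p) {δ : ℝ} (hδ : 0 < δ)
    (h : ∀ x, δ ≤ ‖A p x‖) :
    ∃ B : P → X →ᵇ ℂ, ContDiffAt ℂ ω B p ∧ ∀ᶠ q in 𝓝 p, ∀ x, B q x = (A q x)⁻¹ := by
  have h0 : ∀ x, A p x ≠ 0 := fun x hx => by
    have := h x
    rw [hx, norm_zero] at this
    linarith
  let I : X →ᵇ ℂ := BoundedContinuousFunction.ofNormedAddCommGroup (fun x => (A p x)⁻¹)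
    ((A p).continuous.inv₀ h0) δ⁻¹ fun x => by
      rw [norm_inv]
      exact inv_anti₀ hδ (h x)
  let u : (X →ᵇ ℂ)ˣ := ⟨A p, I, by ext x; exact mul_inv_cancel₀ (h0 x),
    by ext x; exact inv_mul_cancel₀ (h0 x)⟩
  refine ⟨fun q => Ring.inverse (A q), ?_, ?_⟩
  · exact (contDiffAt_ringInverse ℂ u : ContDiffAt ℂ ω Ring.inverse (A p)).comp p hA
  · have hu : ∀ᶠ a in 𝓝 (A p), IsUnit a := Units.isOpen.mem_nhds u.isUnit
    filter_upwards [hA.continuousAt.eventually hu] with q hq x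
    have : Ring.inverse (A q) * A q = 1 := Ring.inverse_mul_cancel _ hq
    exact eq_inv_of_mul_eq_one_left (congrArg (fun g : X →ᵇ ℂ => g x) this)

theorem BoundedContinuousFunction.contDiffAt_integral {X : Type*} [TopologicalSpace X]
    [MeasurableSpace X] [OpensMeasurableSpace X] (μ : Measure X) [IsFiniteMeasure μ]
    {B : P → X →ᵇ ℂ} {p : P} (hB : ContDiffAt ℂ ω B p) :
    ContDiffAt ℂ ω (fun q => ∫ x, B q x ∂μ) p := by
  let Λ : (X →ᵇ ℂ) →L[ℂ] ℂ := LinearMap.mkContinuous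
    { toFun := fun g => ∫ x, g x ∂μ
      map_add' := fun g h => integral_add (g.integrable μ) (h.integrable μ)
      map_smul' := fun c g => integral_smul c _ } (μ.real univ) fun g => by
        exact g.norm_integral_le_mul_norm μ
  exact Λ.contDiff.contDiffAt.comp p hB

theorem contDiffAt_cauchy_kernel (a b : ℝ →ᵇ ℂ) (ℓ : P →L[ℂ] ℂ) (π : C(ℝ × ℝ × ℝ, ℝ)) (p : P)
    {δ : ℝ} (hδ : 0 < δ) (h : ∀ θ, δ ≤ ‖a θ + ℓ p * b θ‖) :
    ∃ B : P → (ℝ × ℝ × ℝ) →ᵇ ℂ, ContDiffAt ℂ ω B p ∧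
      ∀ᶠ q in 𝓝 p, ∀ x, B q x = (a (π x) + ℓ q * b (π x))⁻¹ := by
  let A : P → (ℝ × ℝ × ℝ) →ᵇ ℂ := fun q => a.compContinuous π + ℓ q • b.compContinuous π
  have hA : ContDiff ℂ ω A := contDiff_const.add (ℓ.contDiff.smul contDiff_const)
  exact BoundedContinuousFunction.contDiffAt_inv hA.contDiffAt hδ fun x => h (π x)

end Parametric

/-- The parametrization of a circle as a bounded continuous function. -/
def circleBCF (r : ℝ) : ℝ →ᵇ ℂ :=
  BoundedContinuousFunction.ofNormedAddCommGroup (circleMap 0 r) (continuous_circleMap 0 r) |r|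
    fun θ => by simp

theorem circleBCF_apply (r θ : ℝ) : circleBCF r θ = circleMap 0 r θ := rfl

/-- Cauchy's formula arranged so that the point `u` enters only through the kernel `(circleMap 0 R φ
- u)⁻¹`. -/
theorem cauchy_line {g : ℂ → ℂ} (hg : Differentiable ℂ g) {R : ℝ} {u : ℂ} (hu : ‖u‖ < R) :
    g u = ∫ φ in (0 : ℝ)..2 * Real.pi, (circleMap 0 R φ - u)⁻¹ *
      ((2 * Real.pi * Complex.I)⁻¹ * (circleMap 0 R φ * Complex.I) * g (circleMap 0 R φ)) := by
  have h := hg.diffContOnCl.two_pi_i_inv_smul_circleIntegral_sub_inv_smul (c := 0) (R := R)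
    (w := u) (by simpa using hu)
  rw [← h, circleIntegral, smul_eq_mul, ← intervalIntegral.integral_const_mul]
  congr 1
  ext φ
  simp only [deriv_circleMap, smul_eq_mul]
  ring

/-- The set where the first coordinate does not vanish. -/
def punctured : Set C3 := {p | p.1 ≠ 0}

theorem isOpen_punctured : IsOpen punctured := isOpen_ne_fun continuous_fst continuous_const

theorem ContDiffOn.differentiable_slice₂ {f : C3 → ℂ} (hf : ContDiffOn ℂ ω f punctured) {z : ℂ}
    (hz : z ≠ 0) (w : ℂ) : Differentiable ℂ fun u => f (z, u, w) := fun u =>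
  ((hf.contDiffAt (x := (z, u, w)) (isOpen_punctured.mem_nhds hz)).differentiableAt
    (by simp)).comp u (f := fun u => (z, u, w)) (by fun_prop)

theorem ContDiffOn.differentiable_slice₃ {f : C3 → ℂ} (hf : ContDiffOn ℂ ω f punctured) {z : ℂ}
    (hz : z ≠ 0) (u : ℂ) : Differentiable ℂ fun w => f (z, u, w) := fun w =>
  ((hf.contDiffAt (x := (z, u, w)) (isOpen_punctured.mem_nhds hz)).differentiableAt
    (by simp)).comp w (f := fun w => (z, u, w)) (by fun_prop)

theorem ContDiffOn.differentiableAt_slice₁ {f : C3 → ℂ} (hf : ContDiffOn ℂ ω f punctured) {z : ℂ}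
    (hz : z ≠ 0) (q : ℂ × ℂ) : DifferentiableAt ℂ (fun z => f (z, q)) z :=
  ((hf.contDiffAt (x := (z, q)) (isOpen_punctured.mem_nhds hz)).differentiableAt
    (by simp)).comp z (f := fun z => (z, q)) (by fun_prop)

/-- Cauchy's formula in `u₁` and `u₂` turns the integral into one over a three-dimensional box,
where `q` occurs only in three kernels and the values of `f` are taken on a fixed torus. The kernels
are analytic in `q` as bounded functions, and integration is continuous and linear. The kernel `(a +
z b)⁻¹` covers both `(ζ - z)⁻¹` and `(1 - z ζ)⁻¹`. -/
theorem contDiffAt_integral_kernel {f : C3 → ℂ} (hf : ContDiffOn ℂ ω f punctured) {r : ℝ}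
    (hr : 0 < r) (a b : ℝ →ᵇ ℂ) (p : C3) {δ : ℝ} (hδ : 0 < δ)
    (h : ∀ θ, δ ≤ ‖a θ + p.1 * b θ‖) :
    ContDiffAt ℂ ω (fun q : C3 => ∫ θ in (0 : ℝ)..2 * Real.pi,
      (a θ + q.1 * b θ)⁻¹ * f (circleMap 0 r θ, q.2)) p := by
  have hγ : ∀ {r : ℝ}, 0 < r → ∀ θ, circleMap 0 r θ ≠ 0 := fun hr θ =>
    circleMap_ne_center hr.ne'
  -- A single radius serves the Cauchy formulas in both remaining variables.
  obtain ⟨R, hR0, hRu, hRw⟩ : ∃ R : ℝ, 0 < R ∧ ‖p.2.1‖ < R ∧ ‖p.2.2‖ < R :=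
    ⟨‖p.2.1‖ + ‖p.2.2‖ + 1, by positivity, by linarith [norm_nonneg p.2.2],
      by linarith [norm_nonneg p.2.1]⟩
  -- the density
  let d : ℝ → ℂ := fun φ => (2 * Real.pi * Complex.I)⁻¹ * (circleMap 0 R φ * Complex.I)
  have hd : Continuous d := by
    have := continuous_circleMap 0 R
    fun_prop
  let Fn : ℝ × ℝ × ℝ → ℂ := fun x =>
    d x.2.1 * d x.2.2 * f (circleMap 0 r x.1, circleMap 0 R x.2.1, circleMap 0 R x.2.2)
  have hFc : Continuous Fn := by
    have h1 : Continuous fun x : ℝ × ℝ × ℝ =>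
        f (circleMap 0 r x.1, circleMap 0 R x.2.1, circleMap 0 R x.2.2) := by
      refine hf.continuousOn.comp_continuous ?_ fun x => hγ hr x.1
      have h1 := continuous_circleMap 0 r
      have h2 := continuous_circleMap 0 R
      exact (h1.comp continuous_fst).prodMk ((h2.comp (by fun_prop)).prodMk (h2.comp (by fun_prop)))
    exact ((hd.comp (by fun_prop)).mul (hd.comp (by fun_prop))).mul h1
  obtain ⟨C, hC⟩ : ∃ C, ∀ x, ‖Fn x‖ ≤ C := by
    let K : Set C3 := Metric.sphere 0 r ×ˢ Metric.sphere 0 R ×ˢ Metric.sphere 0 R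
    have hK : IsCompact K :=
      (isCompact_sphere _ _).prod ((isCompact_sphere _ _).prod (isCompact_sphere _ _))
    have hKp : K ⊆ punctured := fun x hx hx0 => by
      have := hx.1
      rw [hx0] at this
      simp at this
      linarith
    obtain ⟨C, hC⟩ := hK.exists_bound_of_continuousOn (hf.continuousOn.mono hKp)
    let D : ℝ := ‖(2 * Real.pi * Complex.I : ℂ)⁻¹‖ * R
    have hD : ∀ φ, ‖d φ‖ = D := fun φ => by
      simp only [d, D, norm_mul, Complex.norm_I, mul_one]
      simp [abs_of_pos hR0]
    refine ⟨D * D * C, fun x => ?_⟩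
    have hx := hC (circleMap 0 r x.1, circleMap 0 R x.2.1, circleMap 0 R x.2.2)
      ⟨by simp [abs_of_pos hr], by simp [abs_of_pos hR0], by simp [abs_of_pos hR0]⟩
    simp only [Fn, norm_mul, hD]
    gcongr
  let F : (ℝ × ℝ × ℝ) →ᵇ ℂ := BoundedContinuousFunction.ofNormedAddCommGroup Fn hFc C hC
  -- the kernels
  obtain ⟨B₁, hB₁, e₁⟩ := contDiffAt_cauchy_kernel a b (ContinuousLinearMap.fst ℂ ℂ (ℂ × ℂ))
    ⟨fun x => x.1, by fun_prop⟩ p hδ h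
  have hdist : ∀ {u : ℂ}, ‖u‖ < R → ∀ θ, R - ‖u‖ ≤
      ‖circleBCF R θ + u * (-1 : ℝ →ᵇ ℂ) θ‖ := fun {u} hu θ => by
    have : ‖circleMap 0 R θ‖ - ‖u‖ ≤ ‖circleMap 0 R θ - u‖ := norm_sub_norm_le _ _
    simpa [circleBCF_apply, abs_of_pos hR0, sub_eq_add_neg] using this
  obtain ⟨B₂, hB₂, e₂⟩ := contDiffAt_cauchy_kernel (circleBCF R) (-1)
    ((ContinuousLinearMap.fst ℂ ℂ ℂ).comp (ContinuousLinearMap.snd ℂ ℂ (ℂ × ℂ)))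
    ⟨fun x => x.2.1, by fun_prop⟩ p (sub_pos.2 hRu) (hdist hRu)
  obtain ⟨B₃, hB₃, e₃⟩ := contDiffAt_cauchy_kernel (circleBCF R) (-1)
    ((ContinuousLinearMap.snd ℂ ℂ ℂ).comp (ContinuousLinearMap.snd ℂ ℂ (ℂ × ℂ)))
    ⟨fun x => x.2.2, by fun_prop⟩ p (sub_pos.2 hRw) (hdist hRw)
  let ν : Measure ℝ := volume.restrict (Ioc 0 (2 * Real.pi))
  -- `F` does not depend on `q`: it carries the values of `f` and the two Cauchy densities.
  have key := BoundedContinuousFunction.contDiffAt_integral (ν.prod (ν.prod ν))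
    (((hB₁.mul hB₂).mul hB₃).mul (contDiffAt_const (c := F)))
  refine key.congr_of_eventuallyEq ?_
  have n₂ : ∀ᶠ q : C3 in 𝓝 p, ‖q.2.1‖ < R :=
    ContinuousAt.eventually_lt (by fun_prop) continuousAt_const hRu
  have n₃ : ∀ᶠ q : C3 in 𝓝 p, ‖q.2.2‖ < R :=
    ContinuousAt.eventually_lt (by fun_prop) continuousAt_const hRw
  filter_upwards [e₁, e₂, e₃, n₂, n₃] with q e₁ e₂ e₃ n₂ n₃
  have hint := (B₁ q * B₂ q * B₃ q * F).integrable (ν.prod (ν.prod ν))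
  have hint' : ∀ θ, Integrable (fun y => (B₁ q * B₂ q * B₃ q * F) (θ, y)) (ν.prod ν) := fun θ =>
    ((B₁ q * B₂ q * B₃ q * F).compContinuous ⟨fun y => (θ, y), by fun_prop⟩).integrable _
  have hν : ∀ g : ℝ → ℂ, ∫ x in (0 : ℝ)..2 * Real.pi, g x = ∫ x, g x ∂ν := fun g =>
    intervalIntegral.integral_of_le (by positivity)
  change _ = ∫ x, (B₁ q * B₂ q * B₃ q * F) x ∂_
  rw [integral_prod _ hint, hν]
  congr 1
  ext θ
  rw [integral_prod _ (hint' θ), cauchy_line (hf.differentiable_slice₂ (hγ hr θ) q.2.2) n₂, hν,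
    ← integral_const_mul]
  congr 1
  ext φ
  rw [cauchy_line (hf.differentiable_slice₃ (hγ hr θ) (circleMap 0 R φ)) n₃, hν,
    ← integral_const_mul, ← integral_const_mul, ← integral_const_mul]
  congr 1
  ext ψ
  have h₁ := e₁ (θ, φ, ψ)
  have h₂ := e₂ (θ, φ, ψ)
  have h₃ := e₃ (θ, φ, ψ)
  simp only [ContinuousMap.coe_mk, ContinuousLinearMap.coe_fst', ContinuousLinearMap.coe_comp,
    Function.comp_apply, ContinuousLinearMap.coe_snd', circleBCF_apply,
    BoundedContinuousFunction.coe_neg, Pi.neg_apply, BoundedContinuousFunction.coe_one,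
    Pi.one_apply, mul_neg, mul_one, ← sub_eq_add_neg] at h₁ h₂ h₃
  have hF : F (θ, φ, ψ) = d φ * d ψ * f (circleMap 0 r θ, circleMap 0 R φ, circleMap 0 R ψ) := rfl
  simp only [BoundedContinuousFunction.coe_mul, Pi.mul_apply, h₁, h₂, h₃, hF, d]
  ring

theorem contDiffAt_circleIntegral_kernel {f : C3 → ℂ} (hf : ContDiffOn ℂ ω f punctured) {r : ℝ}
    (hr : 0 < r) (k : ℂ → ℂ → ℂ) (a b : ℝ →ᵇ ℂ)
    (hk : ∀ z θ, k z (circleMap 0 r θ) = (a θ + z * b θ)⁻¹) (p : C3) {δ : ℝ} (hδ : 0 < δ)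
    (h : ∀ θ, δ ≤ ‖a θ + p.1 * b θ‖) :
    ContDiffAt ℂ ω (fun q : C3 => ∮ ζ in C(0, r), k q.1 ζ * f (ζ, q.2)) p := by
  have hf' : ContDiffOn ℂ ω (fun q : C3 => q.1 * Complex.I * f q) punctured :=
    (contDiffOn_fst.mul contDiffOn_const).mul hf
  convert contDiffAt_integral_kernel hf' hr a b p hδ h using 2 with q
  rw [circleIntegral]
  congr 1
  ext θ
  rw [hk]
  simp only [deriv_circleMap, smul_eq_mul]
  ring

theorem contDiffAt_circleIntegral_sub_inv {f : C3 → ℂ} (hf : ContDiffOn ℂ ω f punctured) {r : ℝ}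
    {p : C3} (hr : ‖p.1‖ < r) :
    ContDiffAt ℂ ω (fun q : C3 => ∮ ζ in C(0, r), (ζ - q.1)⁻¹ * f (ζ, q.2)) p := by
  have hr0 : 0 < r := (norm_nonneg _).trans_lt hr
  refine contDiffAt_circleIntegral_kernel hf hr0 (fun z ζ => (ζ - z)⁻¹) (circleBCF r) (-1)
    (fun z θ => by simp [circleBCF_apply, sub_eq_add_neg]) p (sub_pos.2 hr) fun θ => ?_
  have : ‖circleMap 0 r θ‖ - ‖p.1‖ ≤ ‖circleMap 0 r θ - p.1‖ := norm_sub_norm_le _ _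
  simpa [circleBCF_apply, abs_of_pos hr0, sub_eq_add_neg] using this

theorem contDiffAt_circleIntegral_one_sub_inv {f : C3 → ℂ} (hf : ContDiffOn ℂ ω f punctured)
    {r : ℝ} (hr0 : 0 < r) {p : C3} (hr : ‖p.1‖ * r < 1) :
    ContDiffAt ℂ ω (fun q : C3 => ∮ ζ in C(0, r), (1 - q.1 * ζ)⁻¹ * f (ζ, q.2)) p := by
  refine contDiffAt_circleIntegral_kernel hf hr0 (fun z ζ => (1 - z * ζ)⁻¹) 1 (-circleBCF r)
    (fun z θ => by simp [circleBCF_apply, sub_eq_add_neg]) p (sub_pos.2 hr) fun θ => ?_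
  have : ‖(1 : ℂ)‖ - ‖p.1 * circleMap 0 r θ‖ ≤ ‖1 - p.1 * circleMap 0 r θ‖ := norm_sub_norm_le _ _
  simpa [circleBCF_apply, abs_of_pos hr0, sub_eq_add_neg] using this

theorem circleIntegral_eq_of_differentiableAt {g : ℂ → ℂ} {r R : ℝ} (hr : 0 < r) (hrR : r ≤ R)
    (hg : ∀ ζ, r ≤ ‖ζ‖ → ‖ζ‖ ≤ R → DifferentiableAt ℂ g ζ) :
    (∮ ζ in C(0, R), g ζ) = ∮ ζ in C(0, r), g ζ := by
  refine Complex.circleIntegral_eq_of_differentiable_on_annulus_off_countable hr hrR countable_empty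
    (fun ζ hζ => (hg ζ ?_ ?_).continuousAt.continuousWithinAt) fun ζ hζ => hg ζ ?_ ?_
  · simpa using hζ.2
  · simpa using hζ.1
  · simpa using (not_le.1 (by simpa using hζ.1.2) : r < ‖ζ‖).le
  · simpa using (mem_ball_zero_iff.1 hζ.1.1).le

/-! ### Laurent decomposition in the first variable. -/

/-- The part of the Laurent expansion in the first variable with exponents `≥ 0`. -/
def laurentPlus (f : C3 → ℂ) (q : C3) : ℂ :=
  (2 * Real.pi * Complex.I)⁻¹ * ∮ ζ in C(0, ‖q.1‖ + 1), (ζ - q.1)⁻¹ * f (ζ, q.2)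

/-- The part of the Laurent expansion in the first variable with exponents `< 0`, multiplied by
`z` and expressed in `z⁻¹`. -/
def laurentMinus (f : C3 → ℂ) (q : C3) : ℂ :=
  (2 * Real.pi * Complex.I)⁻¹ * ∮ ζ in C(0, (‖q.1‖ + 1)⁻¹), (1 - q.1 * ζ)⁻¹ * f (ζ, q.2)

theorem contDiff_laurentPlus {f : C3 → ℂ} (hf : ContDiffOn ℂ ω f punctured) :
    ContDiff ℂ ω (laurentPlus f) := by
  refine contDiff_iff_contDiffAt.2 fun p => ?_
  -- The radius in `laurentPlus` moves with `q`. Near `p` it can be replaced by the constant `‖p.1‖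
  -- + 2`, since the integrand is holomorphic between the two circles.
  have h := (contDiffAt_const (c := ((2 * Real.pi * Complex.I)⁻¹ : ℂ))).mul
    (contDiffAt_circleIntegral_sub_inv hf (p := p) (r := ‖p.1‖ + 2) (by linarith))
  refine h.congr_of_eventuallyEq ?_
  have n : ∀ᶠ q : C3 in 𝓝 p, ‖q.1‖ < ‖p.1‖ + 1 :=
    ContinuousAt.eventually_lt (by fun_prop) continuousAt_const (by simp)
  filter_upwards [n] with q hq
  rw [laurentPlus, circleIntegral_eq_of_differentiableAt (r := ‖q.1‖ + 1) (R := ‖p.1‖ + 2)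
    (by positivity) (by linarith)]
  intro ζ h₁ _
  refine DifferentiableAt.mul (DifferentiableAt.inv (by fun_prop) fun h0 => ?_)
    (hf.differentiableAt_slice₁ ?_ _)
  · rw [sub_eq_zero.1 h0] at h₁
    linarith
  · rintro rfl
    rw [norm_zero] at h₁
    linarith [norm_nonneg q.1]

theorem contDiff_laurentMinus {f : C3 → ℂ} (hf : ContDiffOn ℂ ω f punctured) :
    ContDiff ℂ ω (laurentMinus f) := by
  refine contDiff_iff_contDiffAt.2 fun p => ?_
  have hp : 0 < ‖p.1‖ + 2 := by positivity
  -- Here the fixed circle is the smaller one; on both circles and between them `‖q.1 * ζ‖ < 1`, so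
  -- the kernel has no pole.
  have h := (contDiffAt_const (c := ((2 * Real.pi * Complex.I)⁻¹ : ℂ))).mul
    (contDiffAt_circleIntegral_one_sub_inv hf (p := p) (r := (‖p.1‖ + 2)⁻¹) (by positivity)
      (by rw [← div_eq_mul_inv, div_lt_one hp]; linarith))
  refine h.congr_of_eventuallyEq ?_
  have n : ∀ᶠ q : C3 in 𝓝 p, ‖q.1‖ < ‖p.1‖ + 1 :=
    ContinuousAt.eventually_lt (by fun_prop) continuousAt_const (by simp)
  filter_upwards [n] with q hq
  have hq1 : 0 < ‖q.1‖ + 1 := by positivity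
  rw [laurentMinus, circleIntegral_eq_of_differentiableAt (r := (‖p.1‖ + 2)⁻¹) (by positivity)
    (inv_anti₀ hq1 (by linarith))]
  intro ζ h₁ h₂
  refine DifferentiableAt.mul (DifferentiableAt.inv (by fun_prop) fun h0 => ?_)
    (hf.differentiableAt_slice₁ ?_ _)
  · have h3 : ‖q.1 * ζ‖ = 1 := by rw [← sub_eq_zero.1 h0, norm_one]
    rw [norm_mul] at h3
    have h4 : ‖q.1‖ * ‖ζ‖ ≤ ‖q.1‖ * (‖q.1‖ + 1)⁻¹ := by gcongr
    have h5 : ‖q.1‖ * (‖q.1‖ + 1)⁻¹ < 1 := by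
      rw [← div_eq_mul_inv, div_lt_one hq1]
      linarith
    linarith
  · rintro rfl
    rw [norm_zero] at h₁
    exact absurd h₁ (not_le.2 (by positivity))

/-- Cauchy's formula on an annulus around `z`. The difference quotient of `f` at `z` is holomorphic
on the punctured plane, so its integrals over the outer and the inner circle agree; the constant
`f(z)` contributes `2πi f(z)` on the outer circle and nothing on the inner one. -/
theorem laurent_decomposition {f : C3 → ℂ} (hf : ContDiffOn ℂ ω f punctured) {p : C3}
    (hp : p.1 ≠ 0) : f p = laurentPlus f p + p.1⁻¹ * laurentMinus f (p.1⁻¹, p.2) := by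
  obtain ⟨z, q⟩ := p
  change z ≠ 0 at hp
  have hz : 0 < ‖z‖ := norm_pos_iff.2 hp
  set g : ℂ → ℂ := fun ζ => f (ζ, q) with hg
  have hgd : ∀ ζ, ζ ≠ 0 → DifferentiableAt ℂ g ζ := fun ζ hζ => hf.differentiableAt_slice₁ hζ q
  set R := ‖z‖ + 1 with hR
  set r := (‖z⁻¹‖ + 1)⁻¹ with hr
  have hr0 : 0 < r := by positivity
  have hrz : r < ‖z‖ := by
    rw [hr, inv_lt_comm₀ (by positivity) hz, norm_inv]
    linarith
  have hs : {ζ : ℂ | ζ ≠ 0} ∈ 𝓝 z := isOpen_ne.mem_nhds hp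
  have hd : ∀ ζ, ζ ≠ 0 → DifferentiableAt ℂ (dslope g z) ζ := fun ζ hζ =>
    ((Complex.differentiableOn_dslope hs).2 fun ζ hζ =>
      (hgd ζ hζ).differentiableWithinAt).differentiableAt (isOpen_ne.mem_nhds hζ)
  have hslope : ∀ ζ, ‖ζ‖ ≠ ‖z‖ → dslope g z ζ = (ζ - z)⁻¹ * g ζ - (ζ - z)⁻¹ * g z := fun ζ hζ => by
    rw [dslope_of_ne _ (fun h => hζ (by rw [h])), slope_def_field]
    ring
  have hne : ∀ ρ : ℝ, 0 < ρ → ρ ≠ ‖z‖ → ∀ ζ ∈ Metric.sphere (0 : ℂ) ρ, ζ ≠ 0 ∧ ‖ζ‖ ≠ ‖z‖ := by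
    intro ρ h0 h1 ζ hζ
    have : ‖ζ‖ = ρ := by simpa using hζ
    exact ⟨norm_pos_iff.1 (this ▸ h0), this ▸ h1⟩
  have hsub : ∀ ζ : ℂ, ‖ζ‖ ≠ ‖z‖ → ζ - z ≠ 0 := fun ζ hζ h => hζ (by rw [sub_eq_zero.1 h])
  have hci : ∀ ρ : ℝ, 0 < ρ → ρ ≠ ‖z‖ → (∮ ζ in C(0, ρ), dslope g z ζ) =
      (∮ ζ in C(0, ρ), (ζ - z)⁻¹ * g ζ) - ∮ ζ in C(0, ρ), (ζ - z)⁻¹ * g z := by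
    intro ρ h0 h1
    rw [← circleIntegral.integral_sub]
    · exact circleIntegral.integral_congr h0.le fun ζ hζ => hslope ζ (hne ρ h0 h1 ζ hζ).2
    · refine ContinuousOn.circleIntegrable h0.le fun ζ hζ => ?_
      obtain ⟨a, b⟩ := hne ρ h0 h1 ζ hζ
      exact (((continuousAt_id.sub continuousAt_const).inv₀ (hsub ζ b)).mul
        (hgd ζ a).continuousAt).continuousWithinAt
    · refine ContinuousOn.circleIntegrable h0.le fun ζ hζ => ?_
      obtain ⟨a, b⟩ := hne ρ h0 h1 ζ hζ
      exact (((continuousAt_id.sub continuousAt_const).inv₀ (hsub ζ b)).mul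
        continuousAt_const).continuousWithinAt
  -- `dslope` has its singularity at `z` removed, so the circles can be compared although `z` lies
  -- between them.
  have h1 : (∮ ζ in C(0, R), dslope g z ζ) = ∮ ζ in C(0, r), dslope g z ζ :=
    circleIntegral_eq_of_differentiableAt hr0 (by linarith) fun ζ h _ =>
      hd ζ (norm_pos_iff.1 (hr0.trans_le h))
  have hRz : R ≠ ‖z‖ := by simp [hR]
  rw [hci R (by positivity) hRz, hci r hr0 hrz.ne] at h1
  have h2 : (∮ ζ in C(0, R), (ζ - z)⁻¹ * g z) = 2 * Real.pi * Complex.I * g z := by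
    have := (differentiable_const (g z)).diffContOnCl.circleIntegral_sub_inv_smul (c := 0) (R := R)
      (w := z) (by simp [hR])
    simpa using this
  have h3 : (∮ ζ in C(0, r), (ζ - z)⁻¹ * g z) = 0 := by
    refine DiffContOnCl.circleIntegral_eq_zero hr0.le (DifferentiableOn.diffContOnCl fun ζ hζ => ?_)
    have : ‖ζ‖ ≤ r := by simpa using Metric.closure_ball_subset_closedBall hζ
    have hi : DifferentiableAt ℂ (fun ζ => (ζ - z)⁻¹) ζ :=
      DifferentiableAt.inv (by fun_prop) (hsub ζ (this.trans_lt hrz).ne)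
    exact (hi.mul_const (g z)).differentiableWithinAt
  have h4 : (∮ ζ in C(0, r), (ζ - z)⁻¹ * g ζ) =
      -(z⁻¹ * ∮ ζ in C(0, r), (1 - z⁻¹ * ζ)⁻¹ * g ζ) := by
    rw [← circleIntegral.integral_const_mul, ← neg_one_mul, ← circleIntegral.integral_const_mul]
    refine circleIntegral.integral_congr hr0.le fun ζ hζ => ?_
    have := hsub ζ (hne r hr0 hrz.ne ζ hζ).2
    have h5 : 1 - z⁻¹ * ζ ≠ 0 := fun h => this (by field_simp at h; linear_combination -h)
    have h6 : ζ - z = -(z * (1 - z⁻¹ * ζ)) := by field_simp; ring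
    simp only [h6]
    rw [inv_neg, mul_inv]
    ring
  rw [h2, h3, h4] at h1
  have hpi : (2 * Real.pi * Complex.I : ℂ) ≠ 0 := Complex.two_pi_I_ne_zero
  simp only [laurentPlus, laurentMinus]
  change g z = _
  rw [← hR, ← hr]
  field_simp
  field_simp at h1
  linear_combination -h1

end

/-! ### A Liouville argument and division by a coordinate. -/

/-- `φ` is entire and tends to `ψ 0` at infinity, hence is constant. -/
theorem eq_of_eq_comp_inv {φ ψ : ℂ → ℂ} (hφ : Differentiable ℂ φ) (hψ : ContinuousAt ψ 0)
    (h : ∀ ξ, ξ ≠ 0 → φ ξ = ψ ξ⁻¹) (ξ : ℂ) : φ ξ = ψ 0 := by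
  have ht : Tendsto φ (cocompact ℂ) (𝓝 (ψ 0)) := by
    rw [Metric.cobounded_eq_cocompact.symm]
    refine (hψ.tendsto.comp tendsto_inv₀_cobounded).congr' ?_
    filter_upwards [Bornology.eventually_ne_cobounded (0 : ℂ)] with ξ hξ
    exact (h ξ hξ).symm
  rw [hφ.eq_const_of_tendsto_cocompact ht]
  rfl

/-- Division by the first coordinate. -/
theorem ContDiff.exists_eq_add_fst_mul {f : C3 → ℂ} (hf : ContDiff ℂ ω f) :
    ∃ g : C3 → ℂ, ContDiff ℂ ω g ∧ ∀ p, f p = f (0, p.2) + p.1 * g p := by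
  have hF : ContDiffOn ℂ ω (fun p : C3 => p.1⁻¹ * f p) punctured :=
    (contDiffOn_fst.inv fun p hp => hp).mul hf.contDiffOn
  set g := laurentPlus fun p : C3 => p.1⁻¹ * f p
  set k := laurentMinus fun p : C3 => p.1⁻¹ * f p
  have hg : ContDiff ℂ ω g := contDiff_laurentPlus hF
  have hk : ContDiff ℂ ω k := contDiff_laurentMinus hF
  -- The Laurent decomposition of `f / z`, multiplied by `z`.
  have hdec : ∀ p : C3, p.1 ≠ 0 → f p = p.1 * g p + k (p.1⁻¹, p.2) := fun p hp => by
    have h : p.1⁻¹ * f p = g p + p.1⁻¹ * k (p.1⁻¹, p.2) := laurent_decomposition hF hp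
    generalize k (p.1⁻¹, p.2) = x at h
    field_simp at h
    linear_combination h
  refine ⟨g, hg, ?_⟩
  rintro ⟨z, q⟩
  -- `k` is entire in `ξ`, and `f - z g` stays continuous at `z = 0`; by Liouville `k` does not
  -- depend on `ξ` and equals the value at `z = 0`.
  have hconst : ∀ ξ, k (ξ, q) = f (0, q) - 0 * g (0, q) := by
    refine eq_of_eq_comp_inv (ψ := fun z => f (z, q) - z * g (z, q)) ?_ ?_ ?_
    · exact (hk.differentiable (by simp)).comp (by fun_prop)
    · have h1 := hf.continuous
      have h2 := hg.continuous
      exact Continuous.continuousAt (by fun_prop)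
    · intro ξ hξ
      have := hdec (ξ⁻¹, q) (inv_ne_zero hξ)
      simp only [inv_inv] at this
      simp only [this]
      ring
  rcases eq_or_ne z 0 with rfl | hz
  · simp
  · have := hdec (z, q) hz
    simp only [hconst] at this
    simp only [this]
    ring

theorem ContDiff.exists_eq_add_snd_mul {f : C3 → ℂ} (hf : ContDiff ℂ ω f) :
    ∃ g : C3 → ℂ, ContDiff ℂ ω g ∧ ∀ p, f p = f (p.1, 0, p.2.2) + p.2.1 * g p := by
  obtain ⟨g, hg, h⟩ := ContDiff.exists_eq_add_fst_mul
    (f := fun p : C3 => f (p.2.1, p.1, p.2.2)) (hf.comp (by fun_prop))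
  exact ⟨fun p => g (p.2.1, p.1, p.2.2), hg.comp (by fun_prop), fun p => h (p.2.1, p.1, p.2.2)⟩

/-! ### The normal form `(0, z⁻¹ T(u₂), 0)` of a cocycle and its uniqueness. -/

/-- The `V`-coordinates on `W₂` in terms of the `U`-coordinates. -/
def W2trans (p : C3) : C3 := (p.1⁻¹, p.1 ^ 2 * p.2.1, p.2.2)

/-- The components in `U`-coordinates at `p` of the tangent vector of `W₂` with components `v` in
the `V`-coordinates. -/
def W2pull (p v : C3) : C3 :=
  (-(p.1 ^ 2 * v.1), 2 * p.1 * p.2.1 * v.1 + (p.1 ^ 2)⁻¹ * v.2.1, v.2.2)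

/-- Every holomorphic cochain on `U ∩ V` is cohomologous to one of the form `(0, z⁻¹ T(u₂), 0)`. -/
theorem exists_splitting {σ : C3 → C3} (hσ : ContDiffOn ℂ ω σ punctured) :
    ∃ (A B : C3 → C3) (T : ℂ → ℂ), ContDiff ℂ ω A ∧ ContDiff ℂ ω B ∧ ContDiff ℂ ω T ∧
      ∀ p : C3, p.1 ≠ 0 →
        σ p = A p - W2pull p (B (W2trans p)) + (0, p.1⁻¹ * T p.2.2, 0) := by
  have h1 : ContDiffOn ℂ ω (fun p => (σ p).1) punctured := hσ.fst
  have h2 : ContDiffOn ℂ ω (fun p => p.1 * (σ p).2.1) punctured := contDiffOn_fst.mul hσ.snd.fst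
  have h3 : ContDiffOn ℂ ω (fun p => (σ p).2.2) punctured := hσ.snd.snd
  obtain ⟨a, ha, ha'⟩ : ∃ a, ContDiff ℂ ω a ∧ a = laurentPlus (fun p => (σ p).1) :=
    ⟨_, contDiff_laurentPlus h1, rfl⟩
  obtain ⟨c, hc, hc'⟩ : ∃ a, ContDiff ℂ ω a ∧ a = laurentPlus (fun p => (σ p).2.2) :=
    ⟨_, contDiff_laurentPlus h3, rfl⟩
  obtain ⟨α, hα, hα'⟩ : ∃ a, ContDiff ℂ ω a ∧ a = laurentMinus (fun p => (σ p).1) :=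
    ⟨_, contDiff_laurentMinus h1, rfl⟩
  obtain ⟨γ, hγ, hγ'⟩ : ∃ a, ContDiff ℂ ω a ∧ a = laurentMinus (fun p => (σ p).2.2) :=
    ⟨_, contDiff_laurentMinus h3, rfl⟩
  obtain ⟨β, hβ, hβ'⟩ : ∃ a, ContDiff ℂ ω a ∧ a = laurentMinus (fun p => p.1 * (σ p).2.1) :=
    ⟨_, contDiff_laurentMinus h2, rfl⟩
  obtain ⟨b, hb, hb'⟩ : ∃ a, ContDiff ℂ ω a ∧ a = laurentPlus (fun p => p.1 * (σ p).2.1) :=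
    ⟨_, contDiff_laurentPlus h2, rfl⟩
  obtain ⟨b₁, hb₁, eb₁⟩ := hb.exists_eq_add_fst_mul
  obtain ⟨b₂, hb₂, eb₂⟩ := hb.exists_eq_add_snd_mul
  -- The argument `(q.1, q.1² q.2.1, q.2.2)` is `(z⁻¹, u₁, u₂)` in `V`-coordinates. `q.1³ α` cancels
  -- the polar part of the first component, and the `α` term of the second component undoes its side
  -- effect `2 z u₁ b₁`. The second component was multiplied by `z` before splitting, so `β`
  -- collects the exponents `≤ -2`. The `b₂` term removes `z⁻¹ u₁ b₂(0, u₁, u₂)`, which leaves `z⁻¹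
  -- b(0, 0, u₂)`.
  refine ⟨fun p => (a p, b₁ p, c p), fun q => (q.1 ^ 3 * α (q.1, q.1 ^ 2 * q.2.1, q.2.2),
    -(2 * q.1 ^ 2 * q.2.1 * α (q.1, q.1 ^ 2 * q.2.1, q.2.2)) -
      β (q.1, q.1 ^ 2 * q.2.1, q.2.2) - q.1 * q.2.1 * b₂ (0, q.1 ^ 2 * q.2.1, q.2.2),
    -(q.1 * γ (q.1, q.1 ^ 2 * q.2.1, q.2.2))), fun w => b (0, 0, w), ?_, ?_, ?_, ?_⟩
  · exact ha.prodMk (hb₁.prodMk hc)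
  · fun_prop
  · fun_prop
  · rintro ⟨z, u, w⟩ hz
    change z ≠ 0 at hz
    have e1 := laurent_decomposition h1 (p := (z, u, w)) hz
    have e2 := laurent_decomposition h2 (p := (z, u, w)) hz
    have e3 := laurent_decomposition h3 (p := (z, u, w)) hz
    rw [← ha', ← hα'] at e1
    rw [← hb', ← hβ'] at e2
    rw [← hc', ← hγ'] at e3
    have f1 := eb₁ (z, u, w)
    have f2 := eb₂ (0, u, w)
    simp only at e1 e2 e3 f1 f2
    have hu : z⁻¹ ^ 2 * (z ^ 2 * u) = u := by field_simp
    ext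
    · simp only [W2pull, W2trans, Prod.fst_add, Prod.fst_sub, hu, e1]
      field_simp
      ring
    · simp only [W2pull, W2trans, Prod.fst_add, Prod.fst_sub, Prod.snd_add, Prod.snd_sub, hu]
      rw [f1, f2] at e2
      field_simp
      field_simp at e2
      linear_combination e2
    · simp only [W2pull, W2trans, Prod.snd_add, Prod.snd_sub, hu, e3]
      ring

/-- A coboundary of the form `(0, z⁻¹ T(u₂), 0)` vanishes. -/
theorem eq_zero_of_splitting {A B : C3 → C3} {T : ℂ → ℂ} (hA : ContDiff ℂ ω A)
    (hB : ContDiff ℂ ω B)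
    (h : ∀ p : C3, p.1 ≠ 0 → (0, p.1⁻¹ * T p.2.2, 0) = A p - W2pull p (B (W2trans p))) (w : ℂ) :
    T w = 0 := by
  -- On `u₁ = 0` the first `V`-component drops out of the second equation, which becomes `z A₂ - T =
  -- ξ B₂`. The right side vanishes at `ξ = 0`, and evaluation at `z = 0` isolates `T w`.
  have key := eq_of_eq_comp_inv (φ := fun z => z * (A (z, 0, w)).2.1 - T w)
    (ψ := fun ξ => ξ * (B (ξ, 0, w)).2.1) ?_ ?_ ?_ 0
  · simpa using key
  · have := hA.differentiable (by simp)
    fun_prop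
  · have := hB.continuous
    exact Continuous.continuousAt (by fun_prop)
  · intro z hz
    have := congrArg (fun p : C3 => p.2.1) (h (z, 0, w) hz)
    simp only [W2pull, W2trans, Prod.fst_sub, Prod.snd_sub, mul_zero, zero_mul, zero_add] at this
    field_simp at this
    field_simp
    linear_combination -this

/-! ### Parameters as Taylor coefficients of entire functions. -/

theorem hasFPowerSeriesOnBall_entireSum (t : Param) :
    HasFPowerSeriesOnBall (entireSum t) (FormalMultilinearSeries.ofScalars ℂ t.1) 0 ⊤ := by
  have hr : (FormalMultilinearSeries.ofScalars ℂ t.1).radius = ⊤ := by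
    refine FormalMultilinearSeries.radius_eq_top_of_summable_norm _ fun r => ?_
    have := (t.2 (r : ℂ)).norm
    simpa using this
  have := (FormalMultilinearSeries.ofScalars ℂ t.1).hasFPowerSeriesOnBall (by simp [hr])
  rw [hr] at this
  refine this.congr fun w _ => ?_
  change FormalMultilinearSeries.ofScalarsSum t.1 w = _
  rw [FormalMultilinearSeries.ofScalars_sum_eq]
  simp [entireSum]

theorem contDiff_entireSum (t : Param) : ContDiff ℂ ω (entireSum t) := by
  rw [← contDiffOn_univ]
  refine AnalyticOnNhd.contDiffOn (fun w _ => ?_) uniqueDiffOn_univ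
  exact (hasFPowerSeriesOnBall_entireSum t).analyticAt_of_mem (by simp)

theorem entireSum_add (s t : Param) (w : ℂ) : entireSum (s + t) w = entireSum s w + entireSum t w := by
  simp only [entireSum, Submodule.coe_add, Pi.add_apply, add_mul]
  exact (s.2 w).tsum_add (t.2 w)

theorem entireSum_smul (c : ℂ) (t : Param) (w : ℂ) : entireSum (c • t) w = c * entireSum t w := by
  simp only [entireSum, Submodule.coe_smul, Pi.smul_apply, smul_eq_mul, mul_assoc]
  exact tsum_mul_left

theorem entireSum_zero (w : ℂ) : entireSum 0 w = 0 := by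
  simp [entireSum]

theorem eq_zero_of_entireSum {t : Param} (h : ∀ w, entireSum t w = 0) : t = 0 := by
  have h1 := (hasFPowerSeriesOnBall_entireSum t).hasFPowerSeriesAt
  have h2 : entireSum t = 0 := funext h
  rw [h2] at h1
  exact Subtype.ext ((FormalMultilinearSeries.ofScalars_series_eq_zero ℂ).1 h1.eq_zero)

theorem exists_entireSum_eq {T : ℂ → ℂ} (hT : Differentiable ℂ T) :
    ∃ t : Param, ∀ w, entireSum t w = T w := by
  have h : ∀ w, HasSum (fun j : ℕ => ((j.factorial : ℂ)⁻¹ * iteratedDeriv j T 0) * w ^ j) (T w) := by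
    intro w
    have h := Complex.hasSum_taylorSeries_of_entire hT 0 w
    simp only [sub_zero, smul_eq_mul] at h
    refine h.congr_fun fun j => ?_
    ring
  exact ⟨⟨fun j => (j.factorial : ℂ)⁻¹ * iteratedDeriv j T 0, fun w => (h w).summable⟩,
    fun w => (h w).tsum_eq⟩

theorem linearIndependent_single : LinearIndependent ℂ Param.single := by
  refine LinearIndependent.of_comp Param.subtype ?_
  exact Pi.linearIndependent_single_one ℕ ℂ

/-! ### Calculus in charts whose image is the whole model space. -/

section Parametrization

variable {𝕜 : Type*} [NontriviallyNormedField 𝕜]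
  {F : Type*} [NormedAddCommGroup F] [NormedSpace 𝕜 F]
  {M : Type*} [TopologicalSpace M] [ChartedSpace F M]
  {F' : Type*} [NormedAddCommGroup F'] [NormedSpace 𝕜 F']
  {H' : Type*} [TopologicalSpace H'] {I' : ModelWithCorners 𝕜 F' H'}
  {N : Type*} [TopologicalSpace N] [ChartedSpace H' N]
  {F'' : Type*} [NormedAddCommGroup F''] [NormedSpace 𝕜 F'']
  {n : WithTop ℕ∞}

variable (𝕜) in
/-- `j : F → M` is the inverse of a chart `e` of `M` whose image is the whole model space. -/
structure IsChartInverse (j : F → M) (e : OpenPartialHomeomorph M F) : Prop where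
  mem : e ∈ IsManifold.maximalAtlas 𝓘(𝕜, F) ω M
  source : e.source = range j
  left_inv : ∀ p, e (j p) = p

namespace IsChartInverse

variable {j : F → M} {e : OpenPartialHomeomorph M F} (h : IsChartInverse 𝕜 j e)
include h

theorem apply_chart {x : M} (hx : x ∈ range j) : j (e x) = x := by
  obtain ⟨p, rfl⟩ := hx
  rw [h.left_inv]

theorem symm_eq : ⇑e.symm = j := by
  ext p
  have hp : j p ∈ e.source := by
    rw [h.source]
    exact mem_range_self p
  rw [← e.left_inv hp, h.left_inv]

theorem target : e.target = univ := by
  refine eq_univ_of_forall fun p => ?_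
  have hp : j p ∈ e.source := by
    rw [h.source]
    exact mem_range_self p
  simpa [h.left_inv] using e.map_source hp

theorem isOpen_range : IsOpen (range j) := h.source ▸ e.open_source

theorem contMDiffOn_chart : ContMDiffOn 𝓘(𝕜, F) 𝓘(𝕜, F) ω e (range j) :=
  h.source ▸ contMDiffOn_of_mem_maximalAtlas h.mem

theorem contMDiff : ContMDiff 𝓘(𝕜, F) 𝓘(𝕜, F) ω j := by
  have := contMDiffOn_symm_of_mem_maximalAtlas h.mem
  rwa [h.target, h.symm_eq, contMDiffOn_univ] at this

theorem mdifferentiableAt (p : F) : MDifferentiableAt 𝓘(𝕜, F) 𝓘(𝕜, F) j p :=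
  h.contMDiff.mdifferentiable (by simp) p

theorem contMDiffAt_chart (p : F) : ContMDiffAt 𝓘(𝕜, F) 𝓘(𝕜, F) ω e (j p) :=
  h.contMDiffOn_chart.contMDiffAt (h.isOpen_range.mem_nhds (mem_range_self p))

theorem mdifferentiableAt_chart (p : F) : MDifferentiableAt 𝓘(𝕜, F) 𝓘(𝕜, F) e (j p) :=
  (h.contMDiffAt_chart p).mdifferentiableAt (by simp)

theorem mfderiv_chart_apply (p v : F) :
    mfderiv 𝓘(𝕜, F) 𝓘(𝕜, F) e (j p) (mfderiv 𝓘(𝕜, F) 𝓘(𝕜, F) j p v) = v := by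
  have h1 := mfderiv_comp p (h.mdifferentiableAt_chart p) (h.mdifferentiableAt p)
  have h2 : e ∘ j = id := funext h.left_inv
  rw [h2, mfderiv_id] at h1
  exact (congrArg (fun T : F →L[𝕜] F => T v) h1).symm

theorem mfderiv_apply_chart (p : F) (v : TangentSpace 𝓘(𝕜, F) (j p)) :
    mfderiv 𝓘(𝕜, F) 𝓘(𝕜, F) j p (mfderiv 𝓘(𝕜, F) 𝓘(𝕜, F) e (j p) v) = v := by
  have hj : MDifferentiableAt 𝓘(𝕜, F) 𝓘(𝕜, F) j (e (j p)) := h.mdifferentiableAt _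
  have h1 := mfderiv_comp (j p) hj (h.mdifferentiableAt_chart p)
  have h2 : j ∘ e =ᶠ[𝓝 (j p)] id := by
    filter_upwards [h.isOpen_range.mem_nhds (mem_range_self p)] with x hx
    exact h.apply_chart hx
  rw [h2.mfderiv_eq, mfderiv_id, h.left_inv] at h1
  exact (congrArg (fun T : F →L[𝕜] F => T v) h1).symm

theorem mfderiv_injective (p : F) : Function.Injective (mfderiv 𝓘(𝕜, F) 𝓘(𝕜, F) j p) :=
  fun v w hvw => (h.mfderiv_chart_apply p v).symm.trans <|
    (congrArg (fun x => mfderiv 𝓘(𝕜, F) 𝓘(𝕜, F) e (j p) x) hvw).trans (h.mfderiv_chart_apply p w)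

/-- Smoothness of a map on a chart domain can be checked in the chart. -/
theorem contMDiffOn_image_iff {f : M → N} {s : Set F} (hs : IsOpen s) :
    ContMDiffOn 𝓘(𝕜, F) I' n f (j '' s) ↔ ContMDiffOn 𝓘(𝕜, F) I' n (f ∘ j) s := by
  constructor
  · intro hf
    exact hf.comp (h.contMDiff.of_le le_top).contMDiffOn fun p hp => mem_image_of_mem j hp
  · rintro hf _ ⟨p, hp, rfl⟩
    have h1 : ContMDiffAt 𝓘(𝕜, F) I' n (f ∘ j) (e (j p)) := by
      rw [h.left_inv]
      exact hf.contMDiffAt (hs.mem_nhds hp)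
    have h2 := h1.comp (j p) ((h.contMDiffAt_chart p).of_le le_top)
    refine (h2.congr_of_eventuallyEq ?_).contMDiffWithinAt
    filter_upwards [h.isOpen_range.mem_nhds (mem_range_self p)] with x hx
    simp only [Function.comp_apply, h.apply_chart hx]

theorem contMDiffOn_range_iff {f : M → N} :
    ContMDiffOn 𝓘(𝕜, F) I' n f (range j) ↔ ContMDiff 𝓘(𝕜, F) I' n (f ∘ j) := by
  rw [← image_univ, h.contMDiffOn_image_iff isOpen_univ, contMDiffOn_univ]

variable [IsManifold 𝓘(𝕜, F) ω M]

/-- The components of a smooth vector field along a map are smooth. -/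
theorem contDiffOn_components {c : F'' → F} {a : (p : F'') → TangentSpace 𝓘(𝕜, F) (j (c p))}
    {s : Set F''}
    (ha : ContMDiffOn 𝓘(𝕜, F'') 𝓘(𝕜, F).tangent ω
      (fun p => (⟨j (c p), a p⟩ : TangentBundle 𝓘(𝕜, F) M)) s) :
    ContDiffOn 𝕜 ω (fun p => (mfderiv 𝓘(𝕜, F) 𝓘(𝕜, F) e (j (c p)) (a p) : F)) s := by
  have : IsManifold 𝓘(𝕜, F) 1 M := IsManifold.of_le (n := ω) le_top
  have h1 := h.contMDiffOn_chart.contMDiffOn_tangentMapWithin (m := ω) le_top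
    h.isOpen_range.uniqueMDiffOn
  have h2 := h1.comp ha fun p _ => mem_range_self (c p)
  have h3 := (contMDiff_snd_tangentBundle_modelSpace F 𝓘(𝕜, F) (n := ω)).comp_contMDiffOn h2
  refine (contMDiffOn_iff_contDiffOn.1 h3).congr fun p _ => ?_
  have hm : j (c p) ∈ range j := mem_range_self _
  change _ = mfderivWithin 𝓘(𝕜, F) 𝓘(𝕜, F) e (range j) (j (c p)) (a p)
  rw [mfderivWithin_of_isOpen h.isOpen_range hm]

/-- A vector field along a map is smooth if its components are. -/
theorem contMDiffOn_of_components {c α : F'' → F} {s : Set F''} (hc : ContDiffOn 𝕜 ω c s)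
    (hα : ContDiffOn 𝕜 ω α s) :
    ContMDiffOn 𝓘(𝕜, F'') 𝓘(𝕜, F).tangent ω
      (fun p => (⟨j (c p), mfderiv 𝓘(𝕜, F) 𝓘(𝕜, F) j (c p) (α p)⟩ : TangentBundle 𝓘(𝕜, F) M)) s := by
  have : IsManifold 𝓘(𝕜, F) 1 M := IsManifold.of_le (n := ω) le_top
  have h1 : ContMDiff 𝓘(𝕜, F).tangent 𝓘(𝕜, F).tangent ω (tangentMap 𝓘(𝕜, F) 𝓘(𝕜, F) j) :=
    h.contMDiff.contMDiff_tangentMap le_top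
  have h2 : ContMDiffOn 𝓘(𝕜, F'') 𝓘(𝕜, F).tangent ω
      (fun p => (⟨c p, α p⟩ : TangentBundle 𝓘(𝕜, F) F)) s := fun p hp => by
    refine Bundle.contMDiffWithinAt_totalSpace.2 ⟨hc.contMDiffOn p hp, ?_⟩
    refine (hα.contMDiffOn p hp).congr (fun q _ => ?_) ?_ <;> simp
  exact h1.comp_contMDiffOn h2

end IsChartInverse

end Parametrization

/-! ### Tangent vectors on glued spaces. -/

namespace Glued

variable {F : Type*} [NormedAddCommGroup F] {g : OpenPartialHomeomorph F F}

theorem isChartInverse_inU {𝕜 : Type*} [NontriviallyNormedField 𝕜] [NormedSpace 𝕜 F]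
    [IsManifold 𝓘(𝕜, F) ω (Glued g)] :
    IsChartInverse 𝕜 (inU : F → Glued g) (chartU g) where
  mem := IsManifold.subset_maximalAtlas (by simp [atlas, ChartedSpace.atlas])
  source := chartU_source
  left_inv := chartU_inU

theorem isChartInverse_inV {𝕜 : Type*} [NontriviallyNormedField 𝕜] [NormedSpace 𝕜 F]
    [IsManifold 𝓘(𝕜, F) ω (Glued g)] :
    IsChartInverse 𝕜 (inV : F → Glued g) (chartV g) where
  mem := IsManifold.subset_maximalAtlas (by simp [atlas, ChartedSpace.atlas])
  source := chartV_source
  left_inv := chartV_inV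

theorem inV_transition {F : Type*} [TopologicalSpace F] {g : OpenPartialHomeomorph F F} {p : F}
    (hp : p ∈ g.source) : (inV (g p) : Glued g) = inU p :=
  (inU_eq_inV_iff.2 ⟨hp, rfl⟩).symm

/-- Near `g p` the inclusion of `V` is `inU ∘ g.symm`. Asking only for the derivative of `g.symm`
along a line reduces each later change of coordinates to calculus in one variable. -/
theorem mfderiv_inV [NormedSpace ℂ F] [IsManifold 𝓘(ℂ, F) ω (Glued g)] {p v v' : F}
    (hp : p ∈ g.source) (hd : DifferentiableAt ℂ g.symm (g p))
    (hg : HasDerivAt (fun s : ℂ => g.symm (g p + s • v)) v' 0) :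
    (mfderiv 𝓘(ℂ, F) 𝓘(ℂ, F) (inV : F → Glued g) (g p) v : F) =
      (mfderiv 𝓘(ℂ, F) 𝓘(ℂ, F) (inU : F → Glued g) p v' : F) := by
  have hv : fderiv ℂ g.symm (g p) v = v' := by
    have h1 : HasDerivAt (fun s : ℂ => g p + s • v) v 0 := by
      simpa using ((hasDerivAt_id (0 : ℂ)).smul_const v).const_add (g p)
    have hd' : HasFDerivAt g.symm (fderiv ℂ g.symm (g p)) (g p + (0 : ℂ) • v) := by
      simpa using hd.hasFDerivAt
    exact (hd'.comp_hasDerivAt (0 : ℂ) h1).unique hg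
  have h1 : (inV : F → Glued g) =ᶠ[𝓝 (g p)] inU ∘ g.symm := by
    filter_upwards [g.open_target.mem_nhds (g.map_source hp)] with q hq
    rw [Function.comp_apply, ← inV_transition (g.map_target hq), g.right_inv hq]
  have h2 := mfderiv_comp (g p)
    ((isChartInverse_inU (𝕜 := ℂ) (g := g)).mdifferentiableAt (g.symm (g p)))
    hd.mdifferentiableAt
  rw [h1.mfderiv_eq, h2, mfderiv_eq_fderiv]
  change (mfderiv 𝓘(ℂ, F) 𝓘(ℂ, F) (inU : F → Glued g) (g.symm (g p))
    (fderiv ℂ g.symm (g p) v) : F) = _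
  rw [hv, g.left_inv hp]

end Glued

/-! ### Vector fields on `W₂` in components, and the holomorphic `H¹`. -/

theorem totTransition_W2_apply (p : C3) : totTransition (-2) (2 - 2) p = W2trans p := by
  change (p.1⁻¹, p.1 ^ (- -2 : ℤ) * p.2.1, p.1 ^ (-(2 - 2) : ℤ) * p.2.2) = _
  simp [W2trans]

theorem totTransition_W2_symm_apply (p : C3) : (totTransition (-2) (2 - 2)).symm p = W2trans p :=
  totTransition_W2_apply p

namespace Tot

/-- The inclusions of the charts of `W₂`. -/
abbrev inU : C3 → W 2 := Glued.inU

/-- The inclusions of the charts of `W₂`. -/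
abbrev inV : C3 → W 2 := Glued.inV

theorem chartInverseU : IsChartInverse ℂ inU (Glued.chartU _) := Glued.isChartInverse_inU

theorem chartInverseV : IsChartInverse ℂ inV (Glued.chartV _) := Glued.isChartInverse_inV

theorem inV_trans {p : C3} (hp : p.1 ≠ 0) : inV (W2trans p) = inU p := by
  rw [← totTransition_W2_apply]
  exact Glued.inV_transition hp

theorem mfderiv_inV {p : C3} (hp : p.1 ≠ 0) (v : C3) :
    (mfderiv 𝓘(ℂ, C3) 𝓘(ℂ, C3) inV (W2trans p) v : C3) =
      (mfderiv 𝓘(ℂ, C3) 𝓘(ℂ, C3) inU p (W2pull p v) : C3) := by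
  have hT := totTransition_W2_apply p
  have hq : (W2trans p).1 ≠ 0 := inv_ne_zero hp
  have h := Glued.mfderiv_inV (g := totTransition (-2) (2 - 2)) (p := p) (v := v)
    (v' := W2pull p v) hp ?_ ?_
  · rwa [hT] at h
  · have := (totTransition_contDiffOn (-2) (2 - 2)).contDiffAt (x := W2trans p)
      (isOpen_punctured.mem_nhds hq)
    rw [hT]
    exact this.differentiableAt (by simp)
  · rw [hT]
    obtain ⟨z, u, w⟩ := p
    obtain ⟨a, b, c⟩ := v
    change z ≠ 0 at hp
    have e : (fun s : ℂ => (totTransition (-2) (2 - 2)).symm (W2trans (z, u, w) + s • (a, b, c))) =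
        fun s : ℂ => ((z⁻¹ + s * a)⁻¹, (z⁻¹ + s * a) ^ 2 * (z ^ 2 * u + s * b), w + s * c) := by
      ext s : 1
      rw [totTransition_W2_symm_apply]
      rfl
    rw [e]
    have h0 : ∀ x y : ℂ, HasDerivAt (fun s : ℂ => x + s * y) y 0 := fun x y => by
      simpa using ((hasDerivAt_id (0 : ℂ)).mul_const y).const_add x
    have h1 := (h0 z⁻¹ a).inv (by simpa using hp)
    have h2 := ((h0 z⁻¹ a).pow 2).mul (h0 (z ^ 2 * u) b)
    refine HasDerivAt.congr_deriv (h1.prodMk (h2.prodMk (h0 w c))) ?_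
    simp only [W2pull, zero_mul, add_zero, Prod.mk.injEq, and_true, Pi.pow_apply]
    constructor <;> push_cast <;> field_simp

theorem range_inter : W2U ∩ W2V = inU '' punctured := by
  ext x
  constructor
  · rintro ⟨⟨p, rfl⟩, ⟨q, hq⟩⟩
    exact ⟨p, (Glued.inU_eq_inV_iff.1 hq.symm).1, rfl⟩
  · rintro ⟨p, hp, rfl⟩
    exact ⟨⟨p, rfl⟩, ⟨W2trans p, inV_trans hp⟩⟩

/-- The vector field on `U` with given components. -/
def fieldU : (C3 → C3) →ₗ[ℂ] VField (F := C3) (W 2) where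
  toFun A x := (mfderiv 𝓘(ℂ, C3) 𝓘(ℂ, C3) inU (Glued.chartU _ x) (A (Glued.chartU _ x)) : C3)
  map_add' _ _ := funext fun x =>
    map_add (mfderiv 𝓘(ℂ, C3) 𝓘(ℂ, C3) inU (Glued.chartU _ x)) _ _
  map_smul' _ _ := funext fun x =>
    map_smul (mfderiv 𝓘(ℂ, C3) 𝓘(ℂ, C3) inU (Glued.chartU _ x)) _ _

/-- The vector field on `V` with given components. -/
def fieldV (B : C3 → C3) : VField (F := C3) (W 2) := fun x =>
  (mfderiv 𝓘(ℂ, C3) 𝓘(ℂ, C3) inV (Glued.chartV _ x) (B (Glued.chartV _ x)) : C3)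

theorem fieldU_inU (A : C3 → C3) (p : C3) :
    fieldU A (inU p) = mfderiv 𝓘(ℂ, C3) 𝓘(ℂ, C3) inU p (A p) :=
  congrArg (fun q => (mfderiv 𝓘(ℂ, C3) 𝓘(ℂ, C3) inU q (A q) : C3)) (Glued.chartU_inU p)

theorem fieldV_inV (B : C3 → C3) (p : C3) :
    fieldV B (inV p) = mfderiv 𝓘(ℂ, C3) 𝓘(ℂ, C3) inV p (B p) :=
  congrArg (fun q => (mfderiv 𝓘(ℂ, C3) 𝓘(ℂ, C3) inV q (B q) : C3)) (Glued.chartV_inV p)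

theorem fieldU_hasCoords (σ : C3 → C3) : HasCoords (fieldU σ) σ := fun p _ => fieldU_inU σ p

theorem HasCoords.unique {s : VField (F := C3) (W 2)} {σ τ : C3 → C3} (hσ : HasCoords s σ)
    (hτ : HasCoords s τ) {p : C3} (hp : p.1 ≠ 0) : σ p = τ p :=
  chartInverseU.mfderiv_injective p ((hσ p hp).symm.trans (hτ p hp))

theorem HasCoords.sub {s t : VField (F := C3) (W 2)} {σ τ : C3 → C3} (hσ : HasCoords s σ)
    (hτ : HasCoords t τ) : HasCoords (s - t) (σ - τ) := fun p hp => by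
  rw [Pi.sub_apply, hσ p hp, hτ p hp]
  exact (map_sub (mfderiv 𝓘(ℂ, C3) 𝓘(ℂ, C3) inU p) (σ p) (τ p)).symm

/-- Translates sections of the tangent bundle over a part of a chart into their component functions;
it is applied with `O = ℂ³` in either chart and with `O = {z ≠ 0}` in `U`. -/
theorem mem_range_of_param {j : C3 → W 2} {e : OpenPartialHomeomorph (W 2) C3}
    (h : IsChartInverse ℂ j e) {s : VField (F := C3) (W 2)} {O : Set C3} (hO : IsOpen O) :
    s ∈ holVField (F := C3) (j '' O) ↔ ∃ A : C3 → C3, ContDiffOn ℂ ω A O ∧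
      ∀ p ∈ O, s (j p) = mfderiv 𝓘(ℂ, C3) 𝓘(ℂ, C3) j p (A p) := by
  have h1 : s ∈ holVField (F := C3) (j '' O) ↔ ContMDiffOn 𝓘(ℂ, C3) 𝓘(ℂ, C3).tangent ω
      (fun p => (⟨j p, s (j p)⟩ : TangentBundle 𝓘(ℂ, C3) (W 2))) O :=
    h.contMDiffOn_image_iff hO
  rw [h1]
  constructor
  · intro hs
    exact ⟨_, h.contDiffOn_components (c := fun p => p) hs,
      fun p _ => (h.mfderiv_apply_chart p (s (j p))).symm⟩
  · rintro ⟨A, hA, hs⟩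
    refine (h.contMDiffOn_of_components (c := fun p => p) contDiffOn_id hA).congr fun p hp => ?_
    rw [hs p hp]

theorem mem_holVField_U {s : VField (F := C3) (W 2)} :
    s ∈ holVField (F := C3) W2U ↔ ∃ A ∈ {A : C3 → C3 | ContDiff ℂ ω A},
      ∀ p, s (inU p) = mfderiv 𝓘(ℂ, C3) 𝓘(ℂ, C3) inU p (A p) := by
  have := mem_range_of_param chartInverseU (s := s) isOpen_univ
  simpa [W2U, contDiffOn_univ] using this

theorem mem_holVField_V {s : VField (F := C3) (W 2)} :
    s ∈ holVField (F := C3) W2V ↔ ∃ A ∈ {A : C3 → C3 | ContDiff ℂ ω A},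
      ∀ p, s (inV p) = mfderiv 𝓘(ℂ, C3) 𝓘(ℂ, C3) inV p (A p) := by
  have := mem_range_of_param chartInverseV (s := s) isOpen_univ
  simpa [W2V, contDiffOn_univ] using this

theorem mem_holVField_UV {s : VField (F := C3) (W 2)} :
    s ∈ holVField (F := C3) (W2U ∩ W2V) ↔
      ∃ σ : C3 → C3, ContDiffOn ℂ ω σ punctured ∧ HasCoords s σ := by
  rw [range_inter]
  exact mem_range_of_param chartInverseU isOpen_punctured

/-- `S` is the class of admissible component maps: the entire ones for the holomorphic sheaf, the
polynomial ones for the algebraic sheaf. -/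
theorem mem_coboundaries_iff {SU SV : Submodule ℂ (VField (F := C3) (W 2))} {S : Set (C3 → C3)}
    (hU : ∀ s, s ∈ SU ↔ ∃ A ∈ S, ∀ p, s (inU p) = mfderiv 𝓘(ℂ, C3) 𝓘(ℂ, C3) inU p (A p))
    (hV : ∀ s, s ∈ SV ↔ ∃ B ∈ S, ∀ p, s (inV p) = mfderiv 𝓘(ℂ, C3) 𝓘(ℂ, C3) inV p (B p))
    {s : VField (F := C3) (W 2)} {σ : C3 → C3} (hs : HasCoords s σ) :
    s ∈ coboundaries SU SV (W2U ∩ W2V) ↔ ∃ A ∈ S, ∃ B ∈ S, ∀ p : C3, p.1 ≠ 0 →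
      σ p = A p - W2pull p (B (W2trans p)) := by
  have key : ∀ (a b : VField (F := C3) (W 2)) (A B : C3 → C3),
      (∀ p, a (inU p) = mfderiv 𝓘(ℂ, C3) 𝓘(ℂ, C3) inU p (A p)) →
      (∀ p, b (inV p) = mfderiv 𝓘(ℂ, C3) 𝓘(ℂ, C3) inV p (B p)) →
      HasCoords (a - b) fun p => A p - W2pull p (B (W2trans p)) := by
    intro a b A B ha hb p hp
    have h1 : (b (inV (W2trans p)) : C3) =
        (mfderiv 𝓘(ℂ, C3) 𝓘(ℂ, C3) inU p (W2pull p (B (W2trans p))) : C3) := by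
      rw [hb, mfderiv_inV hp]
    have h2 : (b (inV (W2trans p)) : C3) = b (inU p) :=
      congrArg (fun x => (b x : C3)) (inV_trans hp)
    have h3 : (a (inU p) : C3) = (mfderiv 𝓘(ℂ, C3) 𝓘(ℂ, C3) inU p (A p) : C3) := ha p
    refine (congrArg₂ (fun x y : C3 => x - y) h3 (h2.symm.trans h1)).trans ?_
    exact (map_sub (mfderiv 𝓘(ℂ, C3) 𝓘(ℂ, C3) inU p) (A p) _).symm
  constructor
  · rintro ⟨a, ha, b, hb, h⟩
    obtain ⟨A, hA, ha⟩ := (hU a).1 ha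
    obtain ⟨B, hB, hb⟩ := (hV b).1 hb
    refine ⟨A, hA, B, hB, fun p hp => ?_⟩
    refine HasCoords.unique (τ := fun p => A p - W2pull p (B (W2trans p))) hs (fun p hp => ?_) hp
    have hx : inU p ∈ W2U ∩ W2V := range_inter ▸ mem_image_of_mem inU hp
    rw [h _ hx]
    exact key a b A B ha hb p hp
  · rintro ⟨A, hA, B, hB, h⟩
    refine ⟨fieldU A, (hU _).2 ⟨A, hA, fieldU_inU A⟩, fieldV B, (hV _).2 ⟨B, hB, fieldV_inV B⟩, ?_⟩
    rw [range_inter]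
    rintro _ ⟨p, hp, rfl⟩
    rw [hs p hp, h p hp]
    exact (key _ _ A B (fieldU_inU A) (fieldV_inV B) p hp).symm

/-- The cocycle `(0, z⁻¹ ∑ⱼ tⱼ u₂ʲ, 0)`. -/
def cocycle : Param →ₗ[ℂ] (C3 → C3) where
  toFun t p := (0, p.1⁻¹ * entireSum t p.2.2, 0)
  map_add' s t := by
    ext p <;> simp [entireSum_add, mul_add]
  map_smul' c t := by
    ext p <;> simp [entireSum_smul, mul_left_comm]

theorem contDiffOn_cocycle (t : Param) : ContDiffOn ℂ ω (cocycle t) punctured := by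
  have h1 : ContDiff ℂ ω fun p : C3 => entireSum t p.2.2 :=
    (contDiff_entireSum t).comp (by fun_prop)
  exact contDiffOn_const.prodMk
    (((contDiffOn_fst.inv fun p hp => hp).mul h1.contDiffOn).prodMk contDiffOn_const)

/-- The cocycle `(0, z⁻¹ ∑ⱼ tⱼ u₂ʲ, 0)` as a holomorphic vector field on `U ∩ V`. -/
def holCocycle : Param →ₗ[ℂ] holVField (F := C3) (W2U ∩ W2V) :=
  (fieldU ∘ₗ cocycle).codRestrict _ fun t =>
    mem_holVField_UV.2 ⟨cocycle t, contDiffOn_cocycle t, fieldU_hasCoords _⟩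

theorem holCocycle_hasCoords (t : Param) : HasCoords (holCocycle t).1 (cocycle t) :=
  fieldU_hasCoords _

/-- The class of the cocycle `(0, z⁻¹ ∑ⱼ tⱼ u₂ʲ, 0)`. -/
def thetaLin : Param →ₗ[ℂ] H1TW2 := Submodule.mkQ _ ∘ₗ holCocycle

/-- Reduces equality in `H¹` to the equation solved in `exists_splitting`. Bijectivity of `thetaLin`
and the Kodaira–Spencer computation both pass through this form. -/
theorem mk_eq_thetaLin_iff {θ : holVField (F := C3) (W2U ∩ W2V)} {σ : C3 → C3}
    (hσ : HasCoords θ.1 σ) (t : Param) :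
    (Submodule.Quotient.mk θ : H1TW2) = thetaLin t ↔
      ∃ A B : C3 → C3, ContDiff ℂ ω A ∧ ContDiff ℂ ω B ∧ ∀ p : C3, p.1 ≠ 0 →
        σ p = A p - W2pull p (B (W2trans p)) + (0, p.1⁻¹ * entireSum t p.2.2, 0) := by
  change (Submodule.Quotient.mk θ : H1TW2) = Submodule.Quotient.mk (holCocycle t) ↔ _
  rw [Submodule.Quotient.eq]
  change (θ.1 - (holCocycle t).1) ∈ coboundaries _ _ _ ↔ _
  rw [mem_coboundaries_iff (S := {A : C3 → C3 | ContDiff ℂ ω A}) (fun s => mem_holVField_U)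
    (fun s => mem_holVField_V) (HasCoords.sub hσ (holCocycle_hasCoords t))]
  simp only [mem_ofPred_eq, exists_and_left, Pi.sub_apply, sub_eq_iff_eq_add]
  rfl

theorem thetaLin_injective : Function.Injective thetaLin := by
  rw [← LinearMap.ker_eq_bot, LinearMap.ker_eq_bot']
  intro t ht
  have h0 : (Submodule.Quotient.mk (holCocycle t) : H1TW2) = thetaLin 0 := by
    rw [map_zero]
    exact ht
  obtain ⟨A, B, hA, hB, h⟩ := (mk_eq_thetaLin_iff (holCocycle_hasCoords t) 0).1 h0
  refine eq_zero_of_entireSum (eq_zero_of_splitting hA hB fun p hp => ?_)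
  have := h p hp
  simp only [entireSum_zero, mul_zero] at this
  rw [show ((0, 0, 0) : C3) = 0 from rfl, add_zero] at this
  exact this

theorem thetaLin_surjective : Function.Surjective thetaLin := by
  intro c
  obtain ⟨θ, rfl⟩ := Submodule.Quotient.mk_surjective _ c
  obtain ⟨σ, hσ, hθ⟩ := mem_holVField_UV.1 θ.2
  obtain ⟨A, B, T, hA, hB, hT, h⟩ := exists_splitting hσ
  obtain ⟨t, ht⟩ := exists_entireSum_eq (hT.differentiable (by simp))
  refine ⟨t, ((mk_eq_thetaLin_iff hθ t).2 ⟨A, B, hA, hB, fun p hp => ?_⟩).symm⟩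
  rw [h p hp, ht]

/-- The isomorphism of the space of parameters with `H¹(W₂, TW₂)`. -/
def theta : Param ≃ₗ[ℂ] H1TW2 :=
  LinearEquiv.ofBijective thetaLin ⟨thetaLin_injective, thetaLin_surjective⟩

theorem not_finiteDimensional_param : ¬ FiniteDimensional ℂ Param := fun _ =>
  Set.infinite_univ (Set.finite_univ_iff.2 linearIndependent_single.finite)

theorem not_finiteDimensional_H1TW2 : ¬ FiniteDimensional ℂ H1TW2 := fun _ =>
  not_finiteDimensional_param (Module.Finite.equiv theta.symm)

end Tot

/-! ### The algebraic `H¹`: splitting monomial by monomial. -/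

namespace Tot

/-- The monomials in three variables. -/
def monomialFun (i j k : ℕ) (p : C3) : ℂ := p.1 ^ i * p.2.1 ^ j * p.2.2 ^ k

theorem monomialFun_mem (i j k : ℕ) : monomialFun i j k ∈ polyFun :=
  mul_mem (mul_mem (pow_mem (Algebra.subset_adjoin (by simp)) i)
    (pow_mem (Algebra.subset_adjoin (by simp)) j)) (pow_mem (Algebra.subset_adjoin (by simp)) k)

theorem mem_span_monomialFun {f : C3 → ℂ} (hf : f ∈ polyFun) :
    f ∈ Submodule.span ℂ (range fun n : ℕ × ℕ × ℕ => monomialFun n.1 n.2.1 n.2.2) := by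
  have h : f ∈ Subalgebra.toSubmodule polyFun := hf
  rw [polyFun, Algebra.adjoin_eq_span] at h
  refine Submodule.span_mono (fun m hm => ?_) h
  induction hm using Submonoid.closure_induction with
  | mem x hx =>
    rcases hx with rfl | rfl | rfl
    · exact ⟨(1, 0, 0), by ext; simp [monomialFun]⟩
    · exact ⟨(0, 1, 0), by ext; simp [monomialFun]⟩
    · exact ⟨(0, 0, 1), by ext; simp [monomialFun]⟩
  | one => exact ⟨(0, 0, 0), by ext; simp [monomialFun]⟩
  | mul x y _ _ hx hy =>
    obtain ⟨a, rfl⟩ := hx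
    obtain ⟨b, rfl⟩ := hy
    refine ⟨a + b, ?_⟩
    ext p
    simp only [monomialFun, Pi.mul_apply, Prod.fst_add, Prod.snd_add, pow_add]
    ring

theorem contDiff_of_mem_polyFun {f : C3 → ℂ} (hf : f ∈ polyFun) : ContDiff ℂ ω f := by
  induction hf using Algebra.adjoin_induction with
  | mem x hx =>
    rcases hx with rfl | rfl | rfl <;> fun_prop
  | algebraMap r => exact contDiff_const
  | add x y _ _ hx hy => exact hx.add hy
  | mul x y _ _ hx hy => exact hx.mul hy

theorem contDiff_of_mem_polyMap {P : C3 → C3} (hP : P ∈ polyMap) : ContDiff ℂ ω P :=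
  (contDiff_of_mem_polyFun hP.1).prodMk
    ((contDiff_of_mem_polyFun hP.2.1).prodMk (contDiff_of_mem_polyFun hP.2.2))

/-- The cocycle `(0, z⁻¹ T(u₂), 0)` for a polynomial `T`. -/
def polyCocycle : Polynomial ℂ →ₗ[ℂ] (C3 → C3) where
  toFun T p := (0, p.1⁻¹ * T.eval p.2.2, 0)
  map_add' s t := by
    ext p <;> simp [mul_add]
  map_smul' c t := by
    ext p <;> simp [mul_left_comm]

/-- Cochains that are cohomologous to some `(0, z⁻¹ T(u₂), 0)`, via polynomial cochains. -/
def algSplit : Submodule ℂ (C3 → C3) where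
  carrier := {σ | ∃ A ∈ polyMap, ∃ B ∈ polyMap, ∃ T : Polynomial ℂ, ∀ p : C3, p.1 ≠ 0 →
    σ p = A p - W2pull p (B (W2trans p)) + polyCocycle T p}
  add_mem' := by
    rintro σ σ' ⟨A, hA, B, hB, T, h⟩ ⟨A', hA', B', hB', T', h'⟩
    refine ⟨A + A', add_mem hA hA', B + B', add_mem hB hB', T + T', fun p hp => ?_⟩
    rw [Pi.add_apply, h p hp, h' p hp, map_add]
    ext <;> simp [W2pull] <;> ring
  zero_mem' := ⟨0, zero_mem _, 0, zero_mem _, 0, fun p _ => by ext <;> simp [W2pull]⟩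
  smul_mem' := by
    rintro c σ ⟨A, hA, B, hB, T, h⟩
    refine ⟨c • A, polyMap.smul_mem c hA, c • B, polyMap.smul_mem c hB, c • T, fun p hp => ?_⟩
    rw [Pi.smul_apply, h p hp, map_smul]
    ext <;> simp [W2pull] <;> ring

/-- `algSplit` is a subspace and monomials span the polynomials, so splittings need only be written
down for `z^(i-n) u₁ʲ u₂ᵏ` in each component. -/
theorem mem_algSplit_of_linear (φ : (C3 → ℂ) →ₗ[ℂ] (C3 → C3))
    (h : ∀ i j k, φ (monomialFun i j k) ∈ algSplit) {f : C3 → ℂ} (hf : f ∈ polyFun) :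
    φ f ∈ algSplit := by
  have : Submodule.span ℂ (range fun n : ℕ × ℕ × ℕ => monomialFun n.1 n.2.1 n.2.2) ≤
      algSplit.comap φ := by
    rw [Submodule.span_le]
    rintro _ ⟨n, rfl⟩
    exact h _ _ _
  exact this (mem_span_monomialFun hf)

theorem mem_polyMap {a b c : C3 → ℂ} (ha : a ∈ polyFun) (hb : b ∈ polyFun) (hc : c ∈ polyFun) :
    (fun p => (a p, b p, c p)) ∈ polyMap := ⟨ha, hb, hc⟩

theorem algSplit_fst {f : C3 → ℂ} (hf : f ∈ polyFun) (n : ℕ) :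
    (fun p : C3 => (p.1 ^ n)⁻¹ • (f p, (0 : ℂ), (0 : ℂ))) ∈ algSplit := by
  refine mem_algSplit_of_linear
    { toFun := fun f p => (p.1 ^ n)⁻¹ • (f p, (0 : ℂ), (0 : ℂ))
      map_add' := fun f g => by ext p <;> simp [mul_add]
      map_smul' := fun c f => by ext p <;> simp [mul_left_comm] } (fun i j k => ?_) hf
  rcases le_total n i with h | h
  · obtain ⟨m, rfl⟩ := Nat.exists_eq_add_of_le h
    refine ⟨_, mem_polyMap (monomialFun_mem m j k) (zero_mem _) (zero_mem _), 0, zero_mem _, 0,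
      fun p hp => ?_⟩
    ext <;> simp [W2pull, monomialFun]
    field_simp
    ring
  · obtain ⟨m, rfl⟩ := Nat.exists_eq_add_of_le h
    -- Here `z` has exponent `-m`. The power of `ξ` makes up for the factor `z²` of `W2pull` and for
    -- `v₁ʲ = z²ʲ u₁ʲ`; the second entry cancels the resulting term `2 z u₁ b₁`.
    refine ⟨0, zero_mem _, _, mem_polyMap (monomialFun_mem (m + 2 + 2 * j) j k)
      (polyFun.smul_mem (monomialFun_mem (m + 2 * j + 1) (j + 1) k) (-2)) (zero_mem _), 0,
      fun p hp => ?_⟩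
    ext <;> simp [W2pull, W2trans, monomialFun]
    · field_simp
      ring
    · field_simp
      ring

theorem algSplit_snd {f : C3 → ℂ} (hf : f ∈ polyFun) (n : ℕ) :
    (fun p : C3 => (p.1 ^ n)⁻¹ • ((0 : ℂ), f p, (0 : ℂ))) ∈ algSplit := by
  refine mem_algSplit_of_linear
    { toFun := fun f p => (p.1 ^ n)⁻¹ • ((0 : ℂ), f p, (0 : ℂ))
      map_add' := fun f g => by ext p <;> simp [mul_add]
      map_smul' := fun c f => by ext p <;> simp [mul_left_comm] } (fun i j k => ?_) hf
  rcases le_or_gt n i with h | h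
  · obtain ⟨m, rfl⟩ := Nat.exists_eq_add_of_le h
    refine ⟨_, mem_polyMap (zero_mem _) (monomialFun_mem m j k) (zero_mem _), 0, zero_mem _, 0,
      fun p hp => ?_⟩
    ext <;> simp [W2pull, monomialFun, polyCocycle]
    field_simp
    ring
  obtain ⟨m, rfl⟩ := Nat.exists_eq_add_of_lt h
  rcases m with - | m
  -- The exponent of `z` is exactly `-1`. Without a factor `u₁` the monomial survives as a basis
  -- cocycle; with one, it extends to `V`.
  · rcases j with - | j
    · refine ⟨0, zero_mem _, 0, zero_mem _, Polynomial.X ^ k, fun p hp => ?_⟩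
      ext <;> simp [W2pull, monomialFun, polyCocycle]
      field_simp
      ring
    · refine ⟨0, zero_mem _, _, mem_polyMap (zero_mem _)
        (polyFun.smul_mem (monomialFun_mem (2 * j + 1) (j + 1) k) (-1)) (zero_mem _), 0,
        fun p hp => ?_⟩
      ext <;> simp [W2pull, W2trans, monomialFun, polyCocycle]
      field_simp
      ring
  · refine ⟨0, zero_mem _, _, mem_polyMap (zero_mem _)
      (polyFun.smul_mem (monomialFun_mem (m + 2 * j) j k) (-1)) (zero_mem _), 0,
      fun p hp => ?_⟩
    ext <;> simp [W2pull, W2trans, monomialFun, polyCocycle]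
    field_simp
    ring

theorem algSplit_thd {f : C3 → ℂ} (hf : f ∈ polyFun) (n : ℕ) :
    (fun p : C3 => (p.1 ^ n)⁻¹ • ((0 : ℂ), (0 : ℂ), f p)) ∈ algSplit := by
  refine mem_algSplit_of_linear
    { toFun := fun f p => (p.1 ^ n)⁻¹ • ((0 : ℂ), (0 : ℂ), f p)
      map_add' := fun f g => by ext p <;> simp [mul_add]
      map_smul' := fun c f => by ext p <;> simp [mul_left_comm] } (fun i j k => ?_) hf
  rcases le_total n i with h | h
  · obtain ⟨m, rfl⟩ := Nat.exists_eq_add_of_le h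
    refine ⟨_, mem_polyMap (zero_mem _) (zero_mem _) (monomialFun_mem m j k), 0, zero_mem _, 0,
      fun p hp => ?_⟩
    ext <;> simp [W2pull, monomialFun, polyCocycle]
    field_simp
    ring
  · obtain ⟨m, rfl⟩ := Nat.exists_eq_add_of_le h
    refine ⟨0, zero_mem _, _, mem_polyMap (zero_mem _) (zero_mem _)
      (polyFun.smul_mem (monomialFun_mem (m + 2 * j) j k) (-1)), 0,
      fun p hp => ?_⟩
    ext <;> simp [W2pull, W2trans, monomialFun, polyCocycle]
    field_simp
    ring

theorem smul_mem_algSplit {P : C3 → C3} (hP : P ∈ polyMap) (n : ℕ) :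
    (fun p : C3 => (p.1 ^ n)⁻¹ • P p) ∈ algSplit := by
  convert add_mem (add_mem (algSplit_fst hP.1 n) (algSplit_snd hP.2.1 n)) (algSplit_thd hP.2.2 n)
    using 1
  ext p <;> simp

/-- The cocycle `(0, z⁻¹ T(u₂), 0)` as an algebraic vector field on `U ∩ V`. -/
def algCocycle : Polynomial ℂ →ₗ[ℂ] algUV :=
  (fieldU ∘ₗ polyCocycle).codRestrict _ fun T => by
    refine ⟨1, fun p => (0, T.eval p.2.2, 0), mem_polyMap (zero_mem _) ?_ (zero_mem _), ?_⟩
    · have h : (fun p : C3 => T.eval p.2.2) = Polynomial.aeval (fun p : C3 => p.2.2) T := by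
        induction T using Polynomial.induction_on with
        | C a => ext p; simp
        | add f g hf hg => rw [map_add, ← hf, ← hg]; ext p; simp
        | monomial n a _ => ext p; simp
      rw [h]
      exact Algebra.adjoin_mono (by simp) (Polynomial.aeval_mem_adjoin_singleton ℂ _)
    · have h : (fun p : C3 => (p.1 ^ 1)⁻¹ • ((0 : ℂ), T.eval p.2.2, (0 : ℂ))) = polyCocycle T := by
        ext p <;> simp [polyCocycle]
      rw [h]
      exact fieldU_hasCoords _

theorem algCocycle_hasCoords (T : Polynomial ℂ) : HasCoords (algCocycle T).1 (polyCocycle T) :=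
  fieldU_hasCoords _

/-- The algebraic class of the cocycle `(0, z⁻¹ T(u₂), 0)`. -/
def algThetaLin : Polynomial ℂ →ₗ[ℂ] H1TW2alg := Submodule.mkQ _ ∘ₗ algCocycle

theorem mk_eq_algThetaLin_iff {θ : algUV} {σ : C3 → C3} (hσ : HasCoords θ.1 σ)
    (T : Polynomial ℂ) :
    (Submodule.Quotient.mk θ : H1TW2alg) = algThetaLin T ↔
      ∃ A ∈ polyMap, ∃ B ∈ polyMap, ∀ p : C3, p.1 ≠ 0 →
        σ p = A p - W2pull p (B (W2trans p)) + polyCocycle T p := by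
  change (Submodule.Quotient.mk θ : H1TW2alg) = Submodule.Quotient.mk (algCocycle T) ↔ _
  rw [Submodule.Quotient.eq]
  change (θ.1 - (algCocycle T).1) ∈ coboundaries _ _ _ ↔ _
  rw [mem_coboundaries_iff (S := polyMap) (fun s => Iff.rfl) (fun s => Iff.rfl)
    (HasCoords.sub hσ (algCocycle_hasCoords T))]
  simp only [SetLike.mem_coe, Pi.sub_apply, sub_eq_iff_eq_add]

theorem algThetaLin_injective : Function.Injective algThetaLin := by
  rw [← LinearMap.ker_eq_bot, LinearMap.ker_eq_bot']
  intro T hT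
  have h0 : (Submodule.Quotient.mk (algCocycle T) : H1TW2alg) = algThetaLin 0 := by
    rw [map_zero]
    exact hT
  obtain ⟨A, hA, B, hB, h⟩ := (mk_eq_algThetaLin_iff (algCocycle_hasCoords T) 0).1 h0
  refine Polynomial.funext fun w => ?_
  rw [Polynomial.eval_zero]
  refine eq_zero_of_splitting (T := fun w => T.eval w) (contDiff_of_mem_polyMap hA)
    (contDiff_of_mem_polyMap hB) (fun p hp => ?_) w
  have := h p hp
  rw [map_zero, Pi.zero_apply, add_zero] at this
  exact this

theorem algThetaLin_surjective : Function.Surjective algThetaLin := by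
  intro c
  obtain ⟨θ, rfl⟩ := Submodule.Quotient.mk_surjective _ c
  obtain ⟨n, P, hP, hθ⟩ := θ.2
  obtain ⟨A, hA, B, hB, T, h⟩ := smul_mem_algSplit hP n
  exact ⟨T, ((mk_eq_algThetaLin_iff hθ T).2 ⟨A, hA, B, hB, h⟩).symm⟩

theorem exists_algebraic_basis : ∃ b : Module.Basis ℕ ℂ H1TW2alg, ∀ j : ℕ, ∃ θ : algUV,
    HasCoords θ.1 (fun p => (0, p.1⁻¹ * p.2.2 ^ j, 0)) ∧ Submodule.Quotient.mk θ = b j := by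
  refine ⟨(Polynomial.basisMonomials ℂ).map
    (LinearEquiv.ofBijective algThetaLin ⟨algThetaLin_injective, algThetaLin_surjective⟩),
    fun j => ⟨algCocycle (Polynomial.monomial j 1), ?_, ?_⟩⟩
  · convert algCocycle_hasCoords (Polynomial.monomial j 1) using 2 with p
    simp [polyCocycle]
  · simp
    rfl

end Tot

/-! ### Separation, real structure and smooth maps on glued spaces. -/

/-- Points of the same chart are separated inside it. For distinct points of different charts, `(p,
q)` lies off the closed graph of `g`, and so does a product neighbourhood `a × b`; then `a` and `b`
have disjoint images. -/
theorem Glued.t2Space {F : Type*} [TopologicalSpace F] [T2Space F] {g : OpenPartialHomeomorph F F}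
    (hg : IsClosed {x : F × F | x.1 ∈ g.source ∧ g x.1 = x.2}) : T2Space (Glued g) := by
  have hUV : ∀ p q : F, (Glued.inU p : Glued g) ≠ Glued.inV q →
      ∃ u v : Set (Glued g), IsOpen u ∧ IsOpen v ∧ inU p ∈ u ∧ inV q ∈ v ∧ Disjoint u v := by
    intro p q hpq
    have hn : (p, q) ∈ {x : F × F | x.1 ∈ g.source ∧ g x.1 = x.2}ᶜ := fun h =>
      hpq (inU_eq_inV_iff.2 h)
    obtain ⟨a, b, ha, hb, hpa, hqb, hab⟩ := isOpen_prod_iff.1 hg.isOpen_compl p q hn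
    refine ⟨inU '' a, inV '' b, isOpenEmbedding_inU.isOpenMap a ha,
      isOpenEmbedding_inV.isOpenMap b hb, mem_image_of_mem _ hpa, mem_image_of_mem _ hqb, ?_⟩
    rw [Set.disjoint_left]
    rintro _ ⟨p', hp', rfl⟩ ⟨q', hq', h⟩
    exact hab (mk_mem_prod hp' hq') (inU_eq_inV_iff.1 h.symm)
  have hsame : ∀ {j : F → Glued g}, IsOpenEmbedding j → ∀ p q : F, j p ≠ j q →
      ∃ u v : Set (Glued g), IsOpen u ∧ IsOpen v ∧ j p ∈ u ∧ j q ∈ v ∧ Disjoint u v := by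
    intro j hj p q hpq
    obtain ⟨a, b, ha, hb, hpa, hqb, hab⟩ := t2_separation fun h => hpq (congrArg j h)
    exact ⟨j '' a, j '' b, hj.isOpenMap a ha, hj.isOpenMap b hb, mem_image_of_mem _ hpa,
      mem_image_of_mem _ hqb, (disjoint_image_iff hj.injective).2 hab⟩
  refine ⟨fun x y hxy => ?_⟩
  rcases exists_rep x with ⟨p, rfl⟩ | ⟨p, rfl⟩ <;> rcases exists_rep y with ⟨q, rfl⟩ | ⟨q, rfl⟩
  · exact hsame isOpenEmbedding_inU p q hxy
  · exact hUV p q hxy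
  · obtain ⟨u, v, hu, hv, h1, h2, h3⟩ := hUV q p hxy.symm
    exact ⟨v, u, hv, hu, h2, h1, h3.symm⟩
  · exact hsame isOpenEmbedding_inV p q hxy

theorem IsManifold.restrictScalars_real {F : Type*} [NormedAddCommGroup F] [NormedSpace ℂ F]
    [NormedSpace ℝ F] [IsScalarTower ℝ ℂ F] {M : Type*} [TopologicalSpace M] [ChartedSpace F M]
    [IsManifold 𝓘(ℂ, F) ω M] : IsManifold 𝓘(ℝ, F) ω M := by
  refine isManifold_of_contDiffOn _ _ _ fun e e' he he' => ?_
  have h := contMDiffOn_of_mem_contDiffGroupoid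
    (HasGroupoid.compatible (G := contDiffGroupoid ω 𝓘(ℂ, F)) he he')
  have h' := (contMDiffOn_iff_contDiffOn.1 h).restrict_scalars ℝ
  simpa using h'

theorem Glued.contMDiff_iff {𝕜 : Type*} [NontriviallyNormedField 𝕜] {F : Type*}
    [NormedAddCommGroup F] [NormedSpace 𝕜 F] {g : OpenPartialHomeomorph F F}
    [IsManifold 𝓘(𝕜, F) ω (Glued g)] {F' : Type*} [NormedAddCommGroup F'] [NormedSpace 𝕜 F']
    {H' : Type*} [TopologicalSpace H'] {I' : ModelWithCorners 𝕜 F' H'}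
    {N : Type*} [TopologicalSpace N] [ChartedSpace H' N] {n : WithTop ℕ∞} {f : Glued g → N} :
    ContMDiff 𝓘(𝕜, F) I' n f ↔
      ContMDiff 𝓘(𝕜, F) I' n (f ∘ inU) ∧ ContMDiff 𝓘(𝕜, F) I' n (f ∘ inV) := by
  have hU : IsChartInverse 𝕜 (inU : F → Glued g) _ := Glued.isChartInverse_inU
  have hV : IsChartInverse 𝕜 (inV : F → Glued g) _ := Glued.isChartInverse_inV
  rw [← hU.contMDiffOn_range_iff, ← hV.contMDiffOn_range_iff]
  refine ⟨fun h => ⟨h.contMDiffOn, h.contMDiffOn⟩, fun ⟨h1, h2⟩ x => ?_⟩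
  rcases exists_rep x with ⟨p, rfl⟩ | ⟨p, rfl⟩
  · exact h1.contMDiffAt (hU.isOpen_range.mem_nhds (mem_range_self p))
  · exact h2.contMDiffAt (hV.isOpen_range.mem_nhds (mem_range_self p))

/-- Serves the inverse trivialization, whose domain `W 2 × E` is a product and not a glued space. -/
theorem IsChartInverse.contMDiffAt_prod {𝕜 : Type*} [NontriviallyNormedField 𝕜]
    {F : Type*} [NormedAddCommGroup F] [NormedSpace 𝕜 F]
    {M : Type*} [TopologicalSpace M] [ChartedSpace F M] {j : F → M}
    {e : OpenPartialHomeomorph M F} (h : IsChartInverse 𝕜 j e)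
    {E : Type*} [NormedAddCommGroup E] [NormedSpace 𝕜 E]
    {F' : Type*} [NormedAddCommGroup F'] [NormedSpace 𝕜 F']
    {H' : Type*} [TopologicalSpace H'] {I' : ModelWithCorners 𝕜 F' H'}
    {N : Type*} [TopologicalSpace N] [ChartedSpace H' N] {n : WithTop ℕ∞} {f : M × E → N}
    (hf : ContMDiff 𝓘(𝕜, F × E) I' n fun q : F × E => f (j q.1, q.2)) (p : F) (v : E) :
    ContMDiffAt (𝓘(𝕜, F).prod 𝓘(𝕜, E)) I' n f (j p, v) := by
  have h1 : ContMDiffAt (𝓘(𝕜, F).prod 𝓘(𝕜, E)) 𝓘(𝕜, F × E) n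
      (fun x : M × E => (e x.1, x.2)) (j p, v) :=
    (((h.contMDiffAt_chart p).of_le le_top).comp (j p, v) contMDiffAt_fst).prodMk_space
      contMDiffAt_snd
  refine (hf.contMDiffAt.comp (j p, v) h1).congr_of_eventuallyEq ?_
  have : ∀ᶠ x : M × E in 𝓝 (j p, v), x.1 ∈ range j :=
    continuousAt_fst.eventually (h.isOpen_range.mem_nhds (mem_range_self p))
  filter_upwards [this] with x hx
  simp only [Function.comp_apply, h.apply_chart hx]

/-! ### The explicit family is a deformation. -/

namespace Fam

variable {E : Type} [NormedAddCommGroup E] [NormedSpace ℂ E] (L : E →ₗ[ℂ] Param)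
  (hL : IsHolParam L)

theorem famTransition_apply (p : C3 × E) : famTransition L hL p =
    ((p.1.1⁻¹, p.1.1 ^ 2 * p.1.2.1 + p.1.1 * entireSum (L p.2) p.1.2.2, p.1.2.2), p.2) := rfl

instance t2Space : T2Space (Fam L hL) := by
  refine Glued.t2Space ?_
  -- The equation `ξ z = 1` replaces the open condition `z ≠ 0` together with `ξ = z⁻¹`, which
  -- exhibits the graph as closed.
  have e : {x : (C3 × E) × (C3 × E) | x.1 ∈ (famTransition L hL).source ∧
      famTransition L hL x.1 = x.2} = {x | x.2.1.1 * x.1.1.1 = 1} ∩ {x | x.2.1.2.1 =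
        x.1.1.1 ^ 2 * x.1.1.2.1 + x.1.1.1 * entireSum (L x.1.2) x.1.1.2.2} ∩
        {x | x.2.1.2.2 = x.1.1.2.2} ∩ {x | x.2.2 = x.1.2} := by
    ext ⟨⟨⟨z, u, w⟩, e⟩, ⟨⟨z', u', w'⟩, e'⟩⟩
    simp only [famTransition_apply, mem_inter_iff, Set.mem_ofPred_eq, Prod.mk.injEq]
    constructor
    · rintro ⟨hz, ⟨rfl, rfl, rfl⟩, rfl⟩
      exact ⟨⟨⟨inv_mul_cancel₀ hz, rfl⟩, rfl⟩, rfl⟩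
    · rintro ⟨⟨⟨hz, rfl⟩, rfl⟩, rfl⟩
      exact ⟨right_ne_zero_of_mul_eq_one hz, ⟨(eq_inv_of_mul_eq_one_left hz).symm, rfl, rfl⟩, rfl⟩
  rw [e]
  have h : Continuous fun x : (C3 × E) × (C3 × E) => entireSum (L x.1.2) x.1.1.2.2 :=
    hL.continuous.comp (g := fun q : E × ℂ => entireSum (L q.1) q.2)
      (f := fun x : (C3 × E) × (C3 × E) => (x.1.2, x.1.1.2.2)) (by fun_prop)
  refine (((isClosed_eq ?_ ?_).inter (isClosed_eq ?_ ?_)).inter (isClosed_eq ?_ ?_)).inter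
    (isClosed_eq ?_ ?_) <;> fun_prop

instance : IsManifold 𝓘(ℝ, C3) ω (W 2) := IsManifold.restrictScalars_real

instance : IsManifold 𝓘(ℝ, C3 × E) ω (Fam L hL) := IsManifold.restrictScalars_real

/-- The fibrewise translation that makes the family smoothly trivial. -/
def shift (c : ℂ) (p : C3 × E) : C3 × E :=
  ((p.1.1, p.1.2.1 + c * entireSum (L p.2) p.1.2.2 * (starRingEnd ℂ p.1.1 *
    (1 + starRingEnd ℂ p.1.1 * p.1.1)⁻¹), p.1.2.2), p.2)

theorem one_add_conj_mul_ne_zero (z : ℂ) : 1 + starRingEnd ℂ z * z ≠ 0 := by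
  rw [← Complex.normSq_eq_conj_mul_self]
  have : (0 : ℝ) < 1 + Complex.normSq z := by
    have := Complex.normSq_nonneg z
    positivity
  exact_mod_cast this.ne'

include hL in
theorem contDiff_shift (c : ℂ) : ContDiff ℝ ∞ (shift L c) := by
  have h1 : ContDiff ℝ ∞ fun p : C3 × E => entireSum (L p.2) p.1.2.2 :=
    (ContDiff.comp (g := fun q : E × ℂ => entireSum (L q.1) q.2)
      (f := fun p : C3 × E => (p.2, p.1.2.2)) (hL.restrict_scalars ℝ) (by fun_prop)).of_le le_top
  have h2 : ContDiff ℝ ∞ fun p : C3 × E => starRingEnd ℂ p.1.1 :=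
    Complex.conjCLE.contDiff.comp (by fun_prop)
  have h3 : ContDiff ℝ ∞ fun p : C3 × E => (1 + starRingEnd ℂ p.1.1 * p.1.1)⁻¹ :=
    ContDiff.inv (by fun_prop) fun p => one_add_conj_mul_ne_zero _
  unfold shift
  fun_prop

theorem shift_shift (c : ℂ) (p : C3 × E) : shift L (-c) (shift L c p) = p := by
  simp [shift]

theorem shift_zero (c : ℂ) (p : C3) : shift L c (p, 0) = (p, 0) := by
  simp [shift, entireSum_zero]

/-- With `ξ = z⁻¹` one has `ξ̄ / (1 + |ξ|²) = z / (1 + |z|²)`, and `z - z / (1 + |z|²) = z² z̄ / (1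
+ |z|²)`. Thus the shifts by `1` on `U` and `-1` on `V` turn the transition of the family into that
of `W₂`. -/
theorem shift_transition {p : C3 × E} (hp : p.1.1 ≠ 0) :
    shift L (-1) (famTransition L hL p) = (W2trans (shift L 1 p).1, p.2) := by
  obtain ⟨⟨z, u, w⟩, e⟩ := p
  change z ≠ 0 at hp
  have h1 := one_add_conj_mul_ne_zero z
  have h2 := one_add_conj_mul_ne_zero z⁻¹
  have h3 : starRingEnd ℂ z ≠ 0 := by simpa using hp
  rw [map_inv₀] at h2
  simp only [famTransition_apply, shift, W2trans, Prod.mk.injEq, and_true, true_and, map_inv₀]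
  -- The identity is rational in `z` and its conjugate, treated as independent variables.
  generalize starRingEnd ℂ z = y at h1 h2 h3 ⊢
  have h4 : y⁻¹ * (1 + y⁻¹ * z⁻¹)⁻¹ = z * (1 + y * z)⁻¹ := by
    rw [eq_mul_inv_iff_mul_eq₀ h1, mul_comm, ← mul_assoc, ← div_eq_mul_inv, div_eq_iff h2]
    field_simp
    ring
  have h5 : z * (1 + y * z) * (1 + y * z)⁻¹ = z := mul_inv_cancel_right₀ h1 z
  rw [h4]
  linear_combination (-entireSum (L e) w) * h5

/-- The smooth trivialization of the family. -/
def trivMap : Fam L hL → W 2 × E :=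
  Glued.lift (fun p => (Tot.inU (shift L 1 p).1, p.2)) (fun q => (Tot.inV (shift L (-1) q).1, q.2))
    fun p hp => by
      rw [shift_transition L hL hp]
      exact Prod.ext (Tot.inV_trans (p := (shift L 1 p).1) hp).symm rfl

/-- The inverse of the smooth trivialization of the family. -/
def trivInv (x : W 2 × E) : Fam L hL :=
  Glued.lift (fun p => (Glued.inU (shift L (-1) (p, x.2)) : Fam L hL))
    (fun q => Glued.inV (shift L 1 (q, x.2))) (fun p hp => by
      refine Glued.inU_eq_inV_iff.2 ⟨hp, ?_⟩
      have h1 := shift_transition L hL (p := shift L (-1) (p, x.2)) hp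
      have h2 := shift_shift L (-1) (p, x.2)
      have h3 := shift_shift L (-1) (famTransition L hL (shift L (-1) (p, x.2)))
      rw [neg_neg] at h2 h3
      rw [← h3, h1, h2, totTransition_W2_apply]
      rfl) x.1

theorem proj_inU (p : C3 × E) : proj L hL (Glued.inU p) = p.2 := rfl

theorem proj_inV (p : C3 × E) : proj L hL (Glued.inV p) = p.2 := rfl

theorem incl_inU (p : C3) : incl L hL (Tot.inU p) = Glued.inU (p, 0) := rfl

theorem incl_inV (p : C3) : incl L hL (Tot.inV p) = Glued.inV (p, 0) := rfl

theorem contMDiff_trivMap : ContMDiff 𝓘(ℝ, C3 × E) (𝓘(ℝ, C3).prod 𝓘(ℝ, E)) ∞ (trivMap L hL) := by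
  have hU : ContMDiff 𝓘(ℝ, C3) 𝓘(ℝ, C3) ∞ Tot.inU :=
    (Glued.isChartInverse_inU (𝕜 := ℝ)).contMDiff.of_le le_top
  have hV : ContMDiff 𝓘(ℝ, C3) 𝓘(ℝ, C3) ∞ Tot.inV :=
    (Glued.isChartInverse_inV (𝕜 := ℝ)).contMDiff.of_le le_top
  refine Glued.contMDiff_iff.2 ⟨?_, ?_⟩
  · exact (hU.comp (contDiff_shift L hL 1).fst.contMDiff).prodMk contDiff_snd.contMDiff
  · exact (hV.comp (contDiff_shift L hL (-1)).fst.contMDiff).prodMk contDiff_snd.contMDiff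

theorem contMDiff_trivInv : ContMDiff (𝓘(ℝ, C3).prod 𝓘(ℝ, E)) 𝓘(ℝ, C3 × E) ∞ (trivInv L hL) := by
  have hU : ContMDiff 𝓘(ℝ, C3 × E) 𝓘(ℝ, C3 × E) ∞ (Glued.inU : C3 × E → Fam L hL) :=
    (Glued.isChartInverse_inU (𝕜 := ℝ)).contMDiff.of_le le_top
  have hV : ContMDiff 𝓘(ℝ, C3 × E) 𝓘(ℝ, C3 × E) ∞ (Glued.inV : C3 × E → Fam L hL) :=
    (Glued.isChartInverse_inV (𝕜 := ℝ)).contMDiff.of_le le_top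
  rintro ⟨x, e⟩
  rcases Glued.exists_rep x with ⟨p, rfl⟩ | ⟨p, rfl⟩
  · exact (Glued.isChartInverse_inU (𝕜 := ℝ)).contMDiffAt_prod
      (hU.comp (contDiff_shift L hL (-1)).contMDiff) p e
  · exact (Glued.isChartInverse_inV (𝕜 := ℝ)).contMDiffAt_prod
      (hV.comp (contDiff_shift L hL 1).contMDiff) p e

/-- The smooth trivialization of the family as a diffeomorphism. -/
def triv : Diffeomorph 𝓘(ℝ, C3 × E) (𝓘(ℝ, C3).prod 𝓘(ℝ, E)) (Fam L hL) (W 2 × E) ∞ where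
  toFun := trivMap L hL
  invFun := trivInv L hL
  left_inv x := by
    rcases Glued.exists_rep x with ⟨p, rfl⟩ | ⟨p, rfl⟩
    · exact congrArg Glued.inU (shift_shift L 1 p)
    · have := shift_shift L (-1) p
      rw [neg_neg] at this
      exact congrArg Glued.inV this
  right_inv := by
    rintro ⟨x, e⟩
    rcases Glued.exists_rep x with ⟨p, rfl⟩ | ⟨p, rfl⟩
    · have := shift_shift L (-1) (p, e)
      rw [neg_neg] at this
      exact congrArg (fun q : C3 × E => (Tot.inU q.1, q.2)) this
    · exact congrArg (fun q : C3 × E => (Tot.inV q.1, q.2)) (shift_shift L 1 (p, e))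
  contMDiff_toFun := contMDiff_trivMap L hL
  contMDiff_invFun := contMDiff_trivInv L hL

theorem triv_incl (x : W 2) : triv L hL (incl L hL x) = (x, 0) := by
  rcases Glued.exists_rep x with ⟨p, rfl⟩ | ⟨p, rfl⟩
  · exact congrArg (fun q : C3 × E => (Tot.inU q.1, q.2)) (shift_zero L 1 p)
  · exact congrArg (fun q : C3 × E => (Tot.inV q.1, q.2)) (shift_zero L (-1) p)

theorem triv_snd (m : Fam L hL) : (triv L hL m).2 = proj L hL m := by
  rcases Glued.exists_rep m with ⟨p, rfl⟩ | ⟨p, rfl⟩ <;> rfl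

theorem isSubmersion_proj : Manifold.IsSubmersion 𝓘(ℂ, C3 × E) 𝓘(ℂ, E) ω (proj L hL) := by
  refine Manifold.IsSubmersionOfComplement.isSubmersion (F := C3) fun x => ?_
  have key : ∀ {j : C3 × E → Fam L hL} {e : OpenPartialHomeomorph (Fam L hL) (C3 × E)},
      IsChartInverse ℂ j e → (∀ p, proj L hL (j p) = p.2) → ∀ p : C3 × E,
      Manifold.IsSubmersionAtOfComplement C3 𝓘(ℂ, C3 × E) 𝓘(ℂ, E) ω (proj L hL) (j p) := by
    intro j e h hj p
    -- The normal form of a submersion projects to the first factor, hence the swap of `C3 × E`.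
    refine .mk_of_charts (ContinuousLinearEquiv.prodComm ℂ C3 E) e (OpenPartialHomeomorph.refl E)
      (h.source ▸ mem_range_self p) (mem_univ _) h.mem ?_ (fun _ _ => mem_univ _) fun q _ => ?_
    · exact IsManifold.chart_mem_maximalAtlas (I := 𝓘(ℂ, E)) (0 : E)
    · simp [h.symm_eq, hj]
  rcases Glued.exists_rep x with ⟨p, rfl⟩ | ⟨p, rfl⟩
  · exact key Glued.isChartInverse_inU (proj_inU L hL) p
  · exact key Glued.isChartInverse_inV (proj_inV L hL) p

theorem isImmersion_incl : Manifold.IsImmersion 𝓘(ℂ, C3) 𝓘(ℂ, C3 × E) ω (incl L hL) := by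
  refine Manifold.IsImmersionOfComplement.isImmersion (F := E) fun x => ?_
  have key : ∀ {i : C3 → W 2} {d : OpenPartialHomeomorph (W 2) C3} {j : C3 × E → Fam L hL}
      {e : OpenPartialHomeomorph (Fam L hL) (C3 × E)}, IsChartInverse ℂ i d →
      IsChartInverse ℂ j e → (∀ p, incl L hL (i p) = j (p, 0)) → ∀ p : C3,
      Manifold.IsImmersionAtOfComplement E 𝓘(ℂ, C3) 𝓘(ℂ, C3 × E) ω (incl L hL) (i p) := by
    intro i d j e h h' hj p
    refine .mk_of_charts (ContinuousLinearEquiv.refl ℂ (C3 × E)) d e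
      (h.source ▸ mem_range_self p) ?_ h.mem h'.mem ?_ fun q _ => ?_
    · rw [hj, h'.source]
      exact mem_range_self _
    · rw [h.source, h'.source]
      rintro _ ⟨q, rfl⟩
      rw [mem_preimage, hj]
      exact mem_range_self _
    · simp [h.symm_eq, hj, h'.left_inv]
  rcases Glued.exists_rep x with ⟨p, rfl⟩ | ⟨p, rfl⟩
  · exact key Tot.chartInverseU Glued.isChartInverse_inU (incl_inU L hL) p
  · exact key Tot.chartInverseV Glued.isChartInverse_inV (incl_inV L hL) p

/-- After the trivialization the inclusion is `x ↦ (x, 0)`, a topological embedding. -/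
theorem isEmbedding_incl : IsEmbedding (incl L hL) := by
  have h1 : (triv L hL) ∘ incl L hL = fun x => (x, 0) := funext (triv_incl L hL)
  refine .of_comp (isImmersion_incl L hL).contMDiff.continuous (triv L hL).continuous ?_
  rw [h1]
  exact isEmbedding_prodMkLeft 0

theorem isDeformation : IsDeformation (F := C3) (G := C3 × E) (incl L hL) (proj L hL) 0 where
  hausdorff := t2Space L hL
  submersion := isSubmersion_proj L hL
  surjective e := ⟨Glued.inU (0, e), rfl⟩
  embedding := ⟨isImmersion_incl L hL, isEmbedding_incl L hL⟩
  range_eq := by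
    ext m
    constructor
    · rintro ⟨x, rfl⟩
      rcases Glued.exists_rep x with ⟨p, rfl⟩ | ⟨p, rfl⟩ <;> rfl
    · intro hm
      rcases Glued.exists_rep m with ⟨⟨p, e⟩, rfl⟩ | ⟨⟨p, e⟩, rfl⟩
      · obtain rfl : e = 0 := hm
        exact ⟨Tot.inU p, rfl⟩
      · obtain rfl : e = 0 := hm
        exact ⟨Tot.inV p, rfl⟩
  smoothly_trivial := ⟨triv L hL, triv_snd L hL, triv_incl L hL⟩

end Fam

/-! ### The Kodaira–Spencer map. -/

namespace Fam

variable {E : Type} [NormedAddCommGroup E] [NormedSpace ℂ E] (L : E →ₗ[ℂ] Param)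
  (hL : IsHolParam L)

/-- The source of the Kodaira–Spencer class: besides `W2pull`, the change of coordinates contributes
minus the cocycle of `L e`, the derivative of the inverse transition in direction `e`. -/
theorem mfderiv_inV {p : C3} (hp : p.1 ≠ 0) (v : C3) (e : E) :
    (mfderiv 𝓘(ℂ, C3 × E) 𝓘(ℂ, C3 × E) (Glued.inV : C3 × E → Fam L hL) (W2trans p, 0) (v, e) :
      C3 × E) =
    (mfderiv 𝓘(ℂ, C3 × E) 𝓘(ℂ, C3 × E) (Glued.inU : C3 × E → Fam L hL) (p, 0)
      (W2pull p v - (0, p.1⁻¹ * entireSum (L e) p.2.2, 0), e) : C3 × E) := by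
  have hT : famTransition L hL (p, 0) = (W2trans p, 0) := by
    simp [famTransition_apply, W2trans, entireSum_zero]
  have h := Glued.mfderiv_inV (g := famTransition L hL) (p := (p, 0)) (v := (v, e))
    (v' := (W2pull p v - (0, p.1⁻¹ * entireSum (L e) p.2.2, 0), e)) hp ?_ ?_
  · rwa [hT] at h
  · rw [hT]
    have h1 : DifferentiableAt ℂ (fun q : C3 × E => entireSum (L q.2) q.1.2.2) (W2trans p, 0) :=
      ((ContDiff.comp (g := fun q : E × ℂ => entireSum (L q.1) q.2)
        (f := fun p : C3 × E => (p.2, p.1.2.2)) hL (by fun_prop)).differentiable (by simp)) _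
    have h2 : DifferentiableAt ℂ (fun q : C3 × E => q.1.1⁻¹) (W2trans p, 0) :=
      DifferentiableAt.inv (by fun_prop) (inv_ne_zero hp)
    change DifferentiableAt ℂ (fun q : C3 × E => ((q.1.1⁻¹,
      q.1.1 ^ 2 * q.1.2.1 - q.1.1 * entireSum (L q.2) q.1.2.2, q.1.2.2), q.2)) (W2trans p, 0)
    fun_prop
  · rw [hT]
    obtain ⟨z, u, w⟩ := p
    obtain ⟨a, b, c⟩ := v
    change z ≠ 0 at hp
    -- Linearity of `L` makes the deformation term `s` times `entireSum (L e)`, so at `s = 0` only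
    -- its value enters the derivative.
    have e1 : (fun s : ℂ => (famTransition L hL).symm
          ((W2trans (z, u, w), (0 : E)) + s • ((a, b, c), e))) =
        fun s : ℂ => (((z⁻¹ + s * a)⁻¹, (z⁻¹ + s * a) ^ 2 * (z ^ 2 * u + s * b) -
          (z⁻¹ + s * a) * (s * entireSum (L e) (w + s * c)), w + s * c), s • e) := by
      ext s : 1
      rw [← entireSum_smul, ← map_smul, ← zero_add (s • e)]
      rfl
    rw [e1]
    have h0 : ∀ x y : ℂ, HasDerivAt (fun s : ℂ => x + s * y) y 0 := fun x y => by
      simpa using ((hasDerivAt_id (0 : ℂ)).mul_const y).const_add x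
    have h1 := (h0 z⁻¹ a).inv (by simpa using hp)
    have h2 := ((h0 z⁻¹ a).pow 2).mul (h0 (z ^ 2 * u) b)
    have h3 : DifferentiableAt ℂ (fun s : ℂ => entireSum (L e) (w + s * c)) 0 :=
      (((contDiff_entireSum (L e)).differentiable (by simp)).comp
        (g := entireSum (L e)) (f := fun s : ℂ => w + s * c) (by fun_prop)) 0
    have h4 := (h0 z⁻¹ a).mul ((hasDerivAt_id (0 : ℂ)).mul h3.hasDerivAt)
    have h5 : HasDerivAt (fun s : ℂ => s • e) e 0 := by
      simpa using (hasDerivAt_id (0 : ℂ)).smul_const e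
    refine HasDerivAt.congr_deriv ((h1.prodMk ((h2.sub h4).prodMk (h0 w c))).prodMk h5) ?_
    simp only [W2pull, zero_mul, add_zero, Prod.mk.injEq, and_true, Pi.pow_apply, Prod.mk_sub_mk,
      sub_zero, Pi.mul_apply, id, one_mul, mul_zero]
    constructor
    · field_simp
    · push_cast
      field_simp
      ring

theorem contMDiff_proj : ContMDiff 𝓘(ℂ, C3 × E) 𝓘(ℂ, E) ω (proj L hL) :=
  (isSubmersion_proj L hL).contMDiff

theorem contMDiff_incl : ContMDiff 𝓘(ℂ, C3) 𝓘(ℂ, C3 × E) ω (incl L hL) :=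
  (isImmersion_incl L hL).contMDiff

section

variable {i : C3 → W 2} {d : OpenPartialHomeomorph (W 2) C3} (h : IsChartInverse ℂ i d)
  {j : C3 × E → Fam L hL} {k : OpenPartialHomeomorph (Fam L hL) (C3 × E)}
  (h' : IsChartInverse ℂ j k)
include h'

theorem mfderiv_proj (hj : ∀ p, proj L hL (j p) = p.2) (p v : C3 × E) :
    (mfderiv 𝓘(ℂ, C3 × E) 𝓘(ℂ, E) (proj L hL) (j p) (mfderiv 𝓘(ℂ, C3 × E) 𝓘(ℂ, C3 × E) j p v) : E) =
      v.2 := by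
  have h1 := mfderiv_comp p ((contMDiff_proj L hL).mdifferentiable (by simp) (j p))
    (h'.mdifferentiableAt p)
  have h2 : proj L hL ∘ j = Prod.snd := funext hj
  rw [h2, mfderiv_eq_fderiv, fderiv_snd] at h1
  exact (congrArg (fun T : C3 × E →L[ℂ] E => T v) h1).symm

include h in
theorem mfderiv_incl (hi : ∀ p, incl L hL (i p) = j (p, 0)) (p v : C3) :
    (mfderiv 𝓘(ℂ, C3) 𝓘(ℂ, C3 × E) (incl L hL) (i p) (mfderiv 𝓘(ℂ, C3) 𝓘(ℂ, C3) i p v) : C3 × E) =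
      (mfderiv 𝓘(ℂ, C3 × E) 𝓘(ℂ, C3 × E) j (p, 0) (v, 0) : C3 × E) := by
  have h1 := mfderiv_comp p ((contMDiff_incl L hL).mdifferentiable (by simp) (i p))
    (h.mdifferentiableAt p)
  have hd : HasFDerivAt (fun q : C3 => (q, (0 : E))) (ContinuousLinearMap.inl ℂ C3 E) p :=
    (ContinuousLinearMap.inl ℂ C3 E).hasFDerivAt
  have h2 : incl L hL ∘ i = j ∘ fun q => (q, 0) := funext hi
  have h3 := mfderiv_comp p (h'.mdifferentiableAt (p, 0)) hd.differentiableAt.mdifferentiableAt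
  rw [h2, h3, mfderiv_eq_fderiv, hd.fderiv] at h1
  exact (congrArg (fun T : C3 →L[ℂ] C3 × E => T v) h1).symm

include h in
theorem isLift_iff (hi : ∀ p, incl L hL (i p) = j (p, 0)) (hj : ∀ p, proj L hL (j p) = p.2)
    {e : E} {a : (x : W 2) → TangentSpace 𝓘(ℂ, C3 × E) (incl L hL x)} :
    IsLift (F := C3) (incl L hL) (proj L hL) (range i) e a ↔ ∃ α : C3 → C3, ContDiff ℂ ω α ∧
      ∀ p, (a (i p) : C3 × E) =
        (mfderiv 𝓘(ℂ, C3 × E) 𝓘(ℂ, C3 × E) j (p, 0) (α p, e) : C3 × E) := by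
  -- `incl (i p)` and `j (p, 0)` are equal points but not syntactically the same. All tangent spaces
  -- are the model space, so vectors are moved along such equalities unchanged.
  have hcongr : ∀ {x y : Fam L hL} (_ : x = y) (v : C3 × E),
      (⟨x, v⟩ : TangentBundle 𝓘(ℂ, C3 × E) (Fam L hL)) = ⟨y, v⟩ := by
    rintro x _ rfl v
    rfl
  have hmf : ∀ {x y : Fam L hL} (_ : x = y) (v : C3 × E),
      (mfderiv 𝓘(ℂ, C3 × E) 𝓘(ℂ, E) (proj L hL) x v : E) =
        (mfderiv 𝓘(ℂ, C3 × E) 𝓘(ℂ, E) (proj L hL) y v : E) := by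
    rintro x _ rfl v
    rfl
  constructor
  · intro ha
    have h1 : ContMDiff 𝓘(ℂ, C3) 𝓘(ℂ, C3 × E).tangent ω
        (fun p : C3 => (⟨j (p, 0), (a (i p) : C3 × E)⟩ :
          TangentBundle 𝓘(ℂ, C3 × E) (Fam L hL))) := by
      refine (h.contMDiffOn_range_iff.1 ha.holomorphic).congr fun p => ?_
      exact (hcongr (hi p) _).symm
    have h2 := h'.contDiffOn_components (c := fun p : C3 => (p, (0 : E)))
      (a := fun p => (a (i p) : C3 × E)) (s := univ) h1.contMDiffOn
    refine ⟨_, (contDiffOn_univ.1 h2).fst, fun p => ?_⟩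
    have h3 := h'.mfderiv_apply_chart (p, 0) (a (i p) : C3 × E)
    have h4 := ha.lift (i p) (mem_range_self p)
    have h5 := (hmf (hi p) (a (i p))).symm.trans h4
    have h6 := mfderiv_proj L hL h' hj (p, 0)
      (mfderiv 𝓘(ℂ, C3 × E) 𝓘(ℂ, C3 × E) k (j (p, 0)) (a (i p)) : C3 × E)
    have h7 : (mfderiv 𝓘(ℂ, C3 × E) 𝓘(ℂ, C3 × E) k (j (p, 0)) (a (i p)) : C3 × E).2 = e := by
      rw [← h6, ← h5]
      exact congrArg (fun v : C3 × E =>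
        (mfderiv 𝓘(ℂ, C3 × E) 𝓘(ℂ, E) (proj L hL) (j (p, 0)) v : E)) h3
    refine Eq.trans h3.symm ?_
    exact congrArg (fun v : C3 × E => (mfderiv 𝓘(ℂ, C3 × E) 𝓘(ℂ, C3 × E) j (p, 0) v : C3 × E))
      (Prod.ext rfl h7)
  · rintro ⟨α, hα, ha⟩
    refine ⟨h.contMDiffOn_range_iff.2 ?_, ?_⟩
    · have h1 := h'.contMDiffOn_of_components (c := fun p : C3 => (p, (0 : E)))
        (α := fun p => (α p, e)) (s := univ) (by fun_prop) (by fun_prop)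
      rw [contMDiffOn_univ] at h1
      refine h1.congr fun p => ?_
      exact (hcongr (hi p) _).trans
        (congrArg (fun v : C3 × E => (⟨j (p, 0), v⟩ : TangentBundle 𝓘(ℂ, C3 × E) (Fam L hL))) (ha p))
    · rintro _ ⟨p, rfl⟩
      refine (hmf (hi p) (a (i p))).trans ?_
      rw [ha p]
      exact mfderiv_proj L hL h' hj (p, 0) (α p, e)

end

/-- Holomorphic lifts with prescribed components. -/
theorem exists_isLift {i : C3 → W 2} {d : OpenPartialHomeomorph (W 2) C3}
    (h : IsChartInverse ℂ i d) {j : C3 × E → Fam L hL}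
    {k : OpenPartialHomeomorph (Fam L hL) (C3 × E)} (h' : IsChartInverse ℂ j k)
    (hi : ∀ p, incl L hL (i p) = j (p, 0)) (hj : ∀ p, proj L hL (j p) = p.2) (e : E)
    {α : C3 → C3} (hα : ContDiff ℂ ω α) :
    ∃ a : (x : W 2) → TangentSpace 𝓘(ℂ, C3 × E) (incl L hL x),
      IsLift (F := C3) (incl L hL) (proj L hL) (range i) e a ∧ ∀ p, (a (i p) : C3 × E) =
        (mfderiv 𝓘(ℂ, C3 × E) 𝓘(ℂ, C3 × E) j (p, 0) (α p, e) : C3 × E) := by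
  let a : (x : W 2) → TangentSpace 𝓘(ℂ, C3 × E) (incl L hL x) := fun x =>
    (mfderiv 𝓘(ℂ, C3 × E) 𝓘(ℂ, C3 × E) j (d x, 0) (α (d x), e) : C3 × E)
  have ha : ∀ p, (a (i p) : C3 × E) =
      (mfderiv 𝓘(ℂ, C3 × E) 𝓘(ℂ, C3 × E) j (p, 0) (α p, e) : C3 × E) := fun p =>
    congrArg (fun q : C3 => (mfderiv 𝓘(ℂ, C3 × E) 𝓘(ℂ, C3 × E) j (q, 0) (α q, e) : C3 × E))
      (h.left_inv p)
  exact ⟨a, (isLift_iff L hL h h' hi hj).2 ⟨α, hα, ha⟩, ha⟩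

/-- The components of a difference of lifts. -/
theorem mfderiv_incl_eq_sub_iff {α β : C3 → C3} {e : E} {p : C3} (hp : p.1 ≠ 0) {v : C3}
    {a b : (x : W 2) → TangentSpace 𝓘(ℂ, C3 × E) (incl L hL x)}
    (ha : ∀ p, (a (Tot.inU p) : C3 × E) = (mfderiv 𝓘(ℂ, C3 × E) 𝓘(ℂ, C3 × E)
      (Glued.inU : C3 × E → Fam L hL) (p, 0) (α p, e) : C3 × E))
    (hb : ∀ p, (b (Tot.inV p) : C3 × E) = (mfderiv 𝓘(ℂ, C3 × E) 𝓘(ℂ, C3 × E)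
      (Glued.inV : C3 × E → Fam L hL) (p, 0) (β p, e) : C3 × E)) :
    mfderiv 𝓘(ℂ, C3) 𝓘(ℂ, C3 × E) (incl L hL) (Tot.inU p)
        (mfderiv 𝓘(ℂ, C3) 𝓘(ℂ, C3) Tot.inU p v) = a (Tot.inU p) - b (Tot.inU p) ↔
      v = α p - W2pull p (β (W2trans p)) + (0, p.1⁻¹ * entireSum (L e) p.2.2, 0) := by
  let D : C3 × E →L[ℂ] C3 × E := mfderiv 𝓘(ℂ, C3 × E) 𝓘(ℂ, C3 × E)
    (Glued.inU : C3 × E → Fam L hL) (p, 0)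
  have hD : Function.Injective D :=
    (Glued.isChartInverse_inU (𝕜 := ℂ) (g := famTransition L hL)).mfderiv_injective (p, 0)
  have h1 : (mfderiv 𝓘(ℂ, C3) 𝓘(ℂ, C3 × E) (incl L hL) (Tot.inU p)
      (mfderiv 𝓘(ℂ, C3) 𝓘(ℂ, C3) Tot.inU p v) : C3 × E) = D (v, 0) :=
    mfderiv_incl L hL Tot.chartInverseU Glued.isChartInverse_inU (incl_inU L hL) p v
  have h2 : (a (Tot.inU p) : C3 × E) = D (α p, e) := ha p
  have h3 : (b (Tot.inU p) : C3 × E) = D (W2pull p (β (W2trans p)) -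
      (0, p.1⁻¹ * entireSum (L e) p.2.2, 0), e) := by
    have h4 : (b (Tot.inV (W2trans p)) : C3 × E) = b (Tot.inU p) :=
      congrArg (fun x => (b x : C3 × E)) (Tot.inV_trans hp)
    rw [← h4, hb]
    exact mfderiv_inV L hL hp _ e
  change (mfderiv 𝓘(ℂ, C3) 𝓘(ℂ, C3 × E) (incl L hL) (Tot.inU p)
      (mfderiv 𝓘(ℂ, C3) 𝓘(ℂ, C3) Tot.inU p v) : C3 × E) =
    (a (Tot.inU p) : C3 × E) - (b (Tot.inU p) : C3 × E) ↔ _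
  have key : ∀ x y : C3, D (v, 0) = D (x, e) - D (y, e) ↔ v = x - y := fun x y => by
    rw [← map_sub, hD.eq_iff, Prod.mk_sub_mk, sub_self, Prod.mk.injEq]
    simp only [and_true]
  rw [h1, h2, h3]
  refine (key _ _).trans ?_
  rw [sub_sub_eq_add_sub, add_sub_right_comm]

/-- In components, any two lifts `(α, e)` and `(β, e)` differ by the coboundary of `α` and `β` plus
the cocycle of `L e`, so the class does not depend on them. Existence uses `α = β = 0`. -/
theorem isKodairaSpencerClass_iff (e : E) (c : H1TW2) :
    IsKodairaSpencerClass (F := C3) (G := C3 × E) (incl L hL) (proj L hL) W2U W2V e c ↔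
      c = Tot.theta (L e) := by
  change _ ↔ c = Tot.thetaLin (L e)
  have hx : ∀ {p : C3}, p.1 ≠ 0 → Tot.inU p ∈ W2U ∩ W2V := fun hp =>
    Tot.range_inter ▸ mem_image_of_mem Tot.inU hp
  constructor
  · rintro ⟨θ, rfl, a, b, ha, hb, h⟩
    obtain ⟨α, hα, ha⟩ := (isLift_iff L hL Tot.chartInverseU Glued.isChartInverse_inU
      (incl_inU L hL) (proj_inU L hL)).1 ha
    obtain ⟨β, hβ, hb⟩ := (isLift_iff L hL Tot.chartInverseV Glued.isChartInverse_inV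
      (incl_inV L hL) (proj_inV L hL)).1 hb
    obtain ⟨σ, _, hθ⟩ := Tot.mem_holVField_UV.1 θ.2
    refine (Tot.mk_eq_thetaLin_iff hθ _).2 ⟨α, β, hα, hβ, fun p hp => ?_⟩
    have h1 := h _ (hx hp)
    rw [hθ p hp] at h1
    exact (mfderiv_incl_eq_sub_iff L hL hp ha hb).1 h1
  · rintro rfl
    obtain ⟨a, ha, ha'⟩ := exists_isLift L hL Tot.chartInverseU Glued.isChartInverse_inU
      (incl_inU L hL) (proj_inU L hL) e (α := 0) contDiff_const
    obtain ⟨b, hb, hb'⟩ := exists_isLift L hL Tot.chartInverseV Glued.isChartInverse_inV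
      (incl_inV L hL) (proj_inV L hL) e (α := 0) contDiff_const
    refine ⟨Tot.holCocycle (L e), rfl, a, b, ha, hb, ?_⟩
    intro x hx'
    obtain ⟨p, hp, rfl⟩ := Tot.range_inter.subset hx'
    rw [Tot.holCocycle_hasCoords (L e) p hp]
    refine (mfderiv_incl_eq_sub_iff L hL hp ha' hb').2 ?_
    ext <;> simp [W2pull, Tot.cocycle]

end Fam

/-! ### Holomorphic parameter spaces of finite and infinite dimension. -/

open scoped BoundedContinuousFunction

/-- The evaluation `t ↦ ∑ⱼ tⱼ wʲ` as a linear map. -/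
def entireSumLin (w : ℂ) : Param →ₗ[ℂ] ℂ where
  toFun t := entireSum t w
  map_add' s t := entireSum_add s t w
  map_smul' c t := entireSum_smul c t w

/-- In a basis the sum is a finite combination of fixed entire functions of `w` with coefficients
linear in `e`. -/
theorem isHolParam_of_finiteDimensional {E : Type} [NormedAddCommGroup E] [NormedSpace ℂ E]
    [FiniteDimensional ℂ E] (L : E →ₗ[ℂ] Param) : IsHolParam L := by
  let b := Module.finBasis ℂ E
  have h : ∀ (e : E) (w : ℂ), entireSum (L e) w = ∑ i, b.repr e i * entireSum (L (b i)) w := by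
    intro e w
    change entireSumLin w (L e) = _
    conv_lhs => rw [← b.sum_repr e]
    simp only [map_sum, map_smul, smul_eq_mul]
    rfl
  have h' : (fun q : E × ℂ => entireSum (L q.1) q.2) =
      fun q => ∑ i, b.repr q.1 i * entireSum (L (b i)) q.2 := funext fun q => h q.1 q.2
  rw [IsHolParam, h']
  refine ContDiff.sum fun i _ => ContDiff.mul ?_ ((contDiff_entireSum _).comp contDiff_snd)
  exact (LinearMap.toContinuousLinearMap (b.coord i)).contDiff.comp contDiff_fst

/-- The left shift on bounded sequences. -/
def leftShift : (ℕ →ᵇ ℂ) →L[ℂ] (ℕ →ᵇ ℂ) :=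
  BoundedContinuousFunction.compContinuousCLM ℂ ℂ ⟨Nat.succ, continuous_of_discreteTopology⟩

theorem smul_leftShift_pow_apply (w : ℂ) (n : ℕ) (x : ℕ →ᵇ ℂ) (k : ℕ) :
    ((w • leftShift) ^ n) x k = w ^ n * x (k + n) := by
  induction n generalizing k with
  | zero => simp
  | succ n ih =>
    rw [pow_succ']
    change w * ((w • leftShift) ^ n) x (k + 1) = _
    rw [ih, pow_succ', mul_assoc, add_assoc, add_comm 1 n]

/-- The `n`-th power of the shift moves `x n` to position `0`, so evaluating the exponential series
there gives the power series with coefficients `x n / n!`. -/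
theorem hasSum_exp_leftShift (x : ℕ →ᵇ ℂ) (w : ℂ) :
    HasSum (fun n : ℕ => ((n.factorial : ℂ)⁻¹ * x n) * w ^ n)
      (NormedSpace.exp (w • leftShift) x 0) := by
  have h := NormedSpace.exp_series_hasSum_exp' (𝕂 := ℂ) (w • leftShift)
  have h2 := h.mapL ((BoundedContinuousFunction.evalCLM ℂ 0).comp
    (ContinuousLinearMap.apply ℂ (ℕ →ᵇ ℂ) x))
  refine h2.congr_fun fun n => ?_
  change _ = (n.factorial : ℂ)⁻¹ * ((w • leftShift) ^ n) x 0
  rw [smul_leftShift_pow_apply, zero_add]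
  ring

/-- Bounded sequences `x` as parameters `tⱼ = xⱼ / j!`. -/
def boundedParam : (ℕ →ᵇ ℂ) →ₗ[ℂ] Param where
  toFun x := ⟨fun n => (n.factorial : ℂ)⁻¹ * x n, fun w => (hasSum_exp_leftShift x w).summable⟩
  map_add' _ _ := Subtype.ext (funext fun _ => mul_add _ _ _)
  map_smul' _ _ := Subtype.ext (funext fun _ => mul_left_comm _ _ _)

/-- Joint holomorphy is inherited from the operator exponential, which is analytic on the Banach
algebra of bounded operators on `ℕ →ᵇ ℂ`. -/
theorem isHolParam_boundedParam : IsHolParam boundedParam := by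
  have h : ∀ q : (ℕ →ᵇ ℂ) × ℂ, entireSum (boundedParam q.1) q.2 =
      BoundedContinuousFunction.evalCLM ℂ 0 (NormedSpace.exp (q.2 • leftShift) q.1) := fun q =>
    (hasSum_exp_leftShift q.1 q.2).tsum_eq
  have hexp : ContDiff ℂ ω (NormedSpace.exp : ((ℕ →ᵇ ℂ) →L[ℂ] (ℕ →ᵇ ℂ)) → _) := by
    rw [← contDiffOn_univ]
    exact AnalyticOnNhd.contDiffOn (fun T _ => NormedSpace.exp_analytic T) uniqueDiffOn_univ
  unfold IsHolParam
  simp only [h]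
  refine (ContinuousLinearMap.contDiff _).comp (ContDiff.clm_apply (hexp.comp ?_) contDiff_fst)
  exact contDiff_snd.smul contDiff_const

theorem boundedParam_injective : Function.Injective boundedParam := by
  intro x y h
  ext n
  have h1 : (n.factorial : ℂ)⁻¹ * x n = (n.factorial : ℂ)⁻¹ * y n :=
    congrFun (congrArg Subtype.val h) n
  exact mul_left_cancel₀ (inv_ne_zero (by exact_mod_cast n.factorial_ne_zero)) h1

theorem single_mem_range_boundedParam (j : ℕ) :
    Param.single j ∈ LinearMap.range boundedParam := by
  refine ⟨BoundedContinuousFunction.ofNormedAddCommGroupDiscrete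
    (Pi.single j (j.factorial : ℂ)) (j.factorial : ℝ) fun n => ?_, ?_⟩
  · rcases eq_or_ne n j with rfl | h
    · simp
    · simp [Pi.single_eq_of_ne h]
  · refine Subtype.ext (funext fun n => ?_)
    change (n.factorial : ℂ)⁻¹ * Pi.single (M := fun _ => ℂ) j (j.factorial : ℂ) n =
      Pi.single (M := fun _ => ℂ) j 1 n
    rcases eq_or_ne n j with rfl | h
    · simp [n.factorial_ne_zero]
    · simp [Pi.single_eq_of_ne h]

theorem not_finiteDimensional_bounded : ¬ FiniteDimensional ℂ (ℕ →ᵇ ℂ) := fun _ => by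
  choose f hf using single_mem_range_boundedParam
  have h : LinearIndependent ℂ f := LinearIndependent.of_comp boundedParam <| by
    rw [show boundedParam ∘ f = Param.single from funext hf]
    exact linearIndependent_single
  exact Set.infinite_univ (Set.finite_univ_iff.2 h.finite)

theorem Fam.inU_eq_inV_iff {E : Type} [NormedAddCommGroup E] [NormedSpace ℂ E]
    (L : E →ₗ[ℂ] Param) (hL : IsHolParam L) (z u₁ u₂ ξ v₁ v₂ : ℂ) (e e' : E) :
    (Glued.inU ((z, u₁, u₂), e) : Fam L hL) = Glued.inV ((ξ, v₁, v₂), e') ↔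
      z ≠ 0 ∧ ξ = z⁻¹ ∧ v₁ = z ^ 2 * u₁ + ∑' j : ℕ, (L e).1 j * z * u₂ ^ j ∧ v₂ = u₂ ∧ e' = e := by
  have h : ∑' j : ℕ, (L e).1 j * z * u₂ ^ j = z * entireSum (L e) u₂ := by
    rw [entireSum, ← tsum_mul_left]
    congr 1
    ext j
    ring
  rw [Glued.inU_eq_inV_iff, h, Fam.famTransition_apply]
  simp only [Prod.mk.injEq, and_assoc]
  refine and_congr Iff.rfl ?_
  constructor <;> rintro ⟨rfl, rfl, rfl, rfl⟩ <;> exact ⟨rfl, rfl, rfl, rfl⟩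

/-! ### Assembly of the theorem. -/

theorem mainTheorem4 :
    -- `H¹(W₂, TW₂)`, holomorphic: every class has a unique representative
    -- `(0, z⁻¹ ∑ⱼ tⱼ u₂ʲ, 0)` with `∑ⱼ tⱼ wʲ` entire, and `Θ` is this parametrization.
    (∃ Θ : Param ≃ₗ[ℂ] H1TW2,
      (∀ t : Param, ∃ θ : holVField (F := C3) (W2U ∩ W2V),
        HasCoords θ.1 (fun p => (0, p.1⁻¹ * entireSum t p.2.2, 0)) ∧
        Submodule.Quotient.mk θ = Θ t) ∧
      -- The explicit family is a deformation of `W₂`, with the cocycles as Kodaira–Spencer classes.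
      (∀ (E : Type) [NormedAddCommGroup E] [NormedSpace ℂ E] (L : E →ₗ[ℂ] Param)
        (hL : IsHolParam L),
        IsDeformation (F := C3) (G := C3 × E) (Fam.incl L hL) (Fam.proj L hL) 0 ∧
        ∀ (e : E) (c : H1TW2),
          IsKodairaSpencerClass (F := C3) (G := C3 × E) (Fam.incl L hL) (Fam.proj L hL)
            W2U W2V e c ↔ c = Θ (L e))) ∧
    ¬ FiniteDimensional ℂ H1TW2 ∧
    -- `H¹(W₂, TW₂)`, algebraic: the cocycles `(0, z⁻¹ u₂ʲ, 0)` represent a vector space basis.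
    (∃ b : Module.Basis ℕ ℂ H1TW2alg, ∀ j : ℕ, ∃ θ : algUV,
      HasCoords θ.1 (fun p => (0, p.1⁻¹ * p.2.2 ^ j, 0)) ∧ Submodule.Quotient.mk θ = b j) ∧
    -- All classes integrate.
    (∀ c : H1TW2, ∃ (L : ℂ →ₗ[ℂ] Param) (hL : IsHolParam L),
      IsDeformation (F := C3) (G := C3 × ℂ) (Fam.incl L hL) (Fam.proj L hL) 0 ∧
      IsKodairaSpencerClass (F := C3) (G := C3 × ℂ) (Fam.incl L hL) (Fam.proj L hL)
        W2U W2V (1 : ℂ) c) ∧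
    -- The family is holomorphic over every finite-dimensional space of parameters.
    (∀ (E : Type) [NormedAddCommGroup E] [NormedSpace ℂ E] [FiniteDimensional ℂ E]
      (L : E →ₗ[ℂ] Param), IsHolParam L) ∧
    -- It is holomorphic over some infinite-dimensional Banach space of parameters that contains
    -- all finite sequences `(t₀, t₁, …)`.
    (∃ (E : Type) (_ : NormedAddCommGroup E) (_ : NormedSpace ℂ E) (_ : CompleteSpace E)
      (L : E →ₗ[ℂ] Param), IsHolParam L ∧ ¬ FiniteDimensional ℂ E ∧ Function.Injective L ∧
      ∀ j : ℕ, Param.single j ∈ LinearMap.range L) ∧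
    -- The transition of the family.
    (∀ (E : Type) [NormedAddCommGroup E] [NormedSpace ℂ E] (L : E →ₗ[ℂ] Param)
      (hL : IsHolParam L) (z u₁ u₂ ξ v₁ v₂ : ℂ) (e e' : E),
      (Glued.inU ((z, u₁, u₂), e) : Fam L hL) = Glued.inV ((ξ, v₁, v₂), e') ↔
        z ≠ 0 ∧ ξ = z⁻¹ ∧ v₁ = z ^ 2 * u₁ + ∑' j : ℕ, (L e).1 j * z * u₂ ^ j ∧ v₂ = u₂ ∧
          e' = e) := by
  refine ⟨⟨Tot.theta, fun t => ⟨Tot.holCocycle t, Tot.holCocycle_hasCoords t, rfl⟩,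
    fun E _ _ L hL => ⟨Fam.isDeformation L hL, Fam.isKodairaSpencerClass_iff L hL⟩⟩,
    Tot.not_finiteDimensional_H1TW2, Tot.exists_algebraic_basis, fun c => ?_,
    fun E _ _ _ L => isHolParam_of_finiteDimensional L, ?_,
    fun E _ _ L hL => Fam.inU_eq_inV_iff L hL⟩
  -- The line spanned by the parameter of `c`; its tangent vector `1` has Kodaira–Spencer class `c`.
  · let L : ℂ →ₗ[ℂ] Param := LinearMap.toSpanSingleton ℂ Param (Tot.theta.symm c)
    have hL := isHolParam_of_finiteDimensional L
    refine ⟨L, hL, Fam.isDeformation L hL, (Fam.isKodairaSpencerClass_iff L hL 1 c).2 ?_⟩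
    simp [L]
  · exact ⟨ℕ →ᵇ ℂ, inferInstance, inferInstance, inferInstance, boundedParam,
      isHolParam_boundedParam, not_finiteDimensional_bounded, boundedParam_injective,
      single_mem_range_boundedParam⟩
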